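/- Fix $\beta>0$. For $n\ge 1$ and a continuous function $f:\mathbb{R}\to\mathbb{R}$ set $$I(f)=I_n(f)=\int_{-\pi}^{\pi}\cdots\int_{-\pi}^{\pi}\ \prod_{1\le j<k\le n}\big|e^{i\theta_j}+e^{i\theta_k}\big|^{\beta}\ \prod_{j=1}^{n}e^{f(\theta_j)}\,d\theta_j ,\qquad Z_n=\int_{-\pi}^{\pi}\cdots\int_{-\pi}^{\pi}\ \prod_{1\le j<k\le n}\big|e^{i\theta_j}+e^{i\theta_k}\big|^{\beta}\ \prod_{j=1}^{n}d\theta_j .$$ Let $0<q\le 1$ and let $g:\mathbb{R}\to\mathbb{R}$ be $2\pi$-periodic and Hölder continuous with exponent $q$ (that is, $g\in C^{0,q}$). Then, for any fixed $0<\zeta<\frac q2$, as $n\to\infty$, $$I\big(\tfrac{t}{n}g\big)=2^{\beta\frac{n(n-1)}{2}}\Big(\frac{8\pi}{\beta n}\Big)^{\frac{n-1}{2}}\sqrt{n}\;e^{-\frac{1}{2\beta}}\,\big(1+O(n^{-\zeta})\big)\int_{-\pi}^{\pi}e^{t g(\theta)}\,d\theta ,$$ uniformly for $t$ in compact subsets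 of $\mathbb{R}$ (the implied constant may depend on $\beta,q,g,\zeta$ and the compact set, but not on $n$ or $t$). For $g\equiv 0$ the error term can be improved: for any fixed $0<\zeta<1$, as $n\to\infty$, $$Z_n=I(0)=2^{\beta\frac{n(n-1)}{2}}\Big(\frac{8\pi}{\beta n}\Big)^{\frac{n-1}{2}}\sqrt{n}\;e^{-\frac{1}{2\beta}}\,2\pi\,\big(1+O(n^{-\zeta})\big).$$ -/

import Mathlib

namespace AntipodalCircle

/-- The antipodal interaction `∏_{j < k} |e^{i θ_j} + e^{i θ_k}| ^ β`. -/
noncomputable def interaction (β : ℝ) (n : ℕ) (θ : Fin n → ℝ) : ℝ :=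
  ∏ j : Fin n, ∏ k ∈ Finset.Ioi j,
    ‖Complex.exp (Complex.I * (θ j : ℂ)) + Complex.exp (Complex.I * (θ k : ℂ))‖ ^ β

/-- The cube `(-π, π]^n`. -/
def cube (n : ℕ) : Set (Fin n → ℝ) :=
  Set.univ.pi fun _ => Set.Ioc (-Real.pi) Real.pi

/-- The `n`-fold integral `I(f)` of the interaction times `∏_j e^{f(θ_j)}` over `(-π, π]^n`,
with respect to Lebesgue measure. -/
noncomputable def multiIntegral (β : ℝ) (n : ℕ) (f : ℝ → ℝ) : ℝ :=
  ∫ θ in cube n, interaction β n θ * ∏ j : Fin n, Real.exp (f (θ j))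

/-- The partition function `Z_n`: the total mass of the interaction over `(-π, π]^n`. -/
noncomputable def partitionFunction (β : ℝ) (n : ℕ) : ℝ :=
  ∫ θ in cube n, interaction β n θ

/-- `2^{β n(n-1)/2} (8π/(βn))^{(n-1)/2} √n e^{-1/(2β)}`, with real exponents. -/
noncomputable def leadingFactor (β : ℝ) (n : ℕ) : ℝ :=
  (2 : ℝ) ^ (β * ((n : ℝ) * ((n : ℝ) - 1) / 2)) *
    (8 * Real.pi / (β * (n : ℝ))) ^ (((n : ℝ) - 1) / 2) *
    Real.sqrt (n : ℝ) * Real.exp (-(1 / (2 * β)))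

end AntipodalCircle

namespace AntipodalCircle

open MeasureTheory ProbabilityTheory Real Filter Topology
open scoped NNReal ENNReal

/-! Since `|e^{ia} + e^{ib}| = 2|cos((a-b)/2)|`, the interaction is largest when all angles
coincide. Periodicity lets the first angle be fixed, with the others measured from it
(`integral_kernel_mul_exp`). Near the diagonal, `-log cos(u/2) = u²/8 + u⁴/192 + O(u⁶)`. The
quadratic part, summed over pairs, is exactly the exponent in the law of the differences `x_j - x_0`
of `n` independent Gaussians of variance `4/(βn)` (`map_iidGaussian_sub_zero`). Its normalisation
gives `(8π/(βn))^{(n-1)/2} √n`.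

Under this law the quartic part has mean `(1 - 1/n)/(2β)` and variance `O(1/n)`, so its exponential
averages to `e^{-1/(2β)} + O(1/n)` (`integral_exp_neg_pairSum_four`); the sextic part has mean
`O(1/n)`. The upper cosine bound holds for differences up to `π`, so it fails only if some angle is
at least `π/2` from the anchor. That angle and the anchor together cost every other point a factor
`(7/8)^β`. Removing both gives a recursion from `k` to `k + 2` with geometrically small coefficient,
so far configurations are negligible (`exists_farMass_le`).

With the test function present, the average of `g` over the points differs from `g` at the anchor by
`O(n^{-q/2})` on the Gaussian scale `n^{-1/2}`. The integral then factors into the anchored mass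
times `∫ e^{tg}`. The rates obtained include the endpoints `ζ = 1` and `ζ = q/2`. -/

/-! ### Gaussian-type bounds for the cosine -/

theorem mul_cos_le_sin {s : ℝ} (h0 : 0 ≤ s) (h1 : s ≤ π / 2) : s * cos s ≤ sin s := by
  rcases h1.lt_or_eq with h | h
  · have hc : 0 < cos s := cos_pos_of_mem_Ioo ⟨by linarith [pi_pos], h⟩
    have := Real.le_tan h0 h
    rw [tan_eq_sin_div_cos, le_div_iff₀ hc] at this
    exact this
  · subst h; simp

/-- The logarithmic derivative reduces this to `s + s³/3 ≤ tan s`, which is handled in the form `(s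
+ s³/3) cos s ≤ sin s` to avoid dividing by the cosine at `π/2`. -/
theorem cos_le_exp_of_nonneg {s : ℝ} (h0 : 0 ≤ s) (h1 : s ≤ π / 2) :
    cos s ≤ exp (-(s ^ 2 / 2 + s ^ 4 / 12)) := by
  have hsin : MonotoneOn (fun s : ℝ => sin s - (s + s ^ 3 / 3) * cos s) (Set.Icc 0 (π / 2)) := by
    refine monotoneOn_of_deriv_nonneg (convex_Icc _ _) (by fun_prop) (by fun_prop) fun x hx => ?_
    rw [interior_Icc] at hx
    have hd : HasDerivAt (fun s : ℝ => sin s - (s + s ^ 3 / 3) * cos s)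
        (cos x - ((1 + (3 * x ^ 2) / 3) * cos x + (x + x ^ 3 / 3) * (-sin x))) x :=
      HasDerivAt.congr_deriv ((hasDerivAt_sin x).sub
        (((hasDerivAt_id x).add ((hasDerivAt_pow 3 x).div_const 3)).mul (hasDerivAt_cos x))) (by simp)
    rw [hd.deriv]
    have h2 := mul_cos_le_sin hx.1.le hx.2.le
    have h3 : 0 ≤ sin x := sin_nonneg_of_nonneg_of_le_pi hx.1.le (by linarith [hx.2, pi_pos])
    nlinarith [mul_nonneg hx.1.le (sub_nonneg.2 h2), mul_nonneg (pow_nonneg hx.1.le 3) h3]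
  have hanti : AntitoneOn (fun s : ℝ => exp (s ^ 2 / 2 + s ^ 4 / 12) * cos s)
      (Set.Icc 0 (π / 2)) := by
    refine antitoneOn_of_deriv_nonpos (convex_Icc _ _) (by fun_prop) (by fun_prop) fun x hx => ?_
    rw [interior_Icc] at hx
    have hd : HasDerivAt (fun s : ℝ => exp (s ^ 2 / 2 + s ^ 4 / 12) * cos s)
        (exp (x ^ 2 / 2 + x ^ 4 / 12) * ((2 * x) / 2 + (4 * x ^ 3) / 12) * cos x +
          exp (x ^ 2 / 2 + x ^ 4 / 12) * (-sin x)) x :=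
      HasDerivAt.congr_deriv (((((hasDerivAt_pow 2 x).div_const 2).add
        ((hasDerivAt_pow 4 x).div_const 12)).exp).mul (hasDerivAt_cos x)) (by simp)
    rw [hd.deriv]
    have h2 := hsin (Set.left_mem_Icc.2 (by positivity)) (Set.mem_Icc_of_Ioo hx) hx.1.le
    simp only [sin_zero] at h2
    have h3 := exp_pos (x ^ 2 / 2 + x ^ 4 / 12)
    have : 0 ≤ sin x - (x + x ^ 3 / 3) * cos x := by simpa using h2
    nlinarith [mul_nonneg h3.le this]
  have := hanti (Set.left_mem_Icc.2 (by positivity)) ⟨h0, h1⟩ h0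
  rw [exp_neg, ← one_div, le_div_iff₀ (exp_pos _), mul_comm]
  simpa using this

/-- Mirror of `cos_le_exp_of_nonneg`. The tangent is now bounded above by `s + s³/3 + (2/3)s⁵`,
whose integral produces the `s⁶/9`; this fails near `π/2`, hence the smaller range. -/
theorem exp_le_cos_of_nonneg {s : ℝ} (h0 : 0 ≤ s) (h1 : s ≤ 1 / 2) :
    exp (-(s ^ 2 / 2 + s ^ 4 / 12 + s ^ 6 / 9)) ≤ cos s := by
  have hsin : MonotoneOn (fun s : ℝ => (s + s ^ 3 / 3 + 2 / 3 * s ^ 5) * cos s - sin s)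
      (Set.Icc 0 (1 / 2)) := by
    refine monotoneOn_of_deriv_nonneg (convex_Icc _ _) (by fun_prop) (by fun_prop) fun x hx => ?_
    rw [interior_Icc] at hx
    have hd : HasDerivAt (fun s : ℝ => (s + s ^ 3 / 3 + 2 / 3 * s ^ 5) * cos s - sin s)
        ((1 + (3 * x ^ 2) / 3 + 2 / 3 * (5 * x ^ 4)) * cos x +
          (x + x ^ 3 / 3 + 2 / 3 * x ^ 5) * (-sin x) - cos x) x :=
      HasDerivAt.congr_deriv (((((hasDerivAt_id x).add ((hasDerivAt_pow 3 x).div_const 3)).add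
        ((hasDerivAt_pow 5 x).const_mul (2 / 3))).mul (hasDerivAt_cos x)).sub (hasDerivAt_sin x)) (by simp)
    rw [hd.deriv]
    have hx0 := hx.1.le
    have h2 : sin x ≤ x := sin_le hx0
    have h3 : 1 - x ^ 2 / 2 ≤ cos x := one_sub_sq_div_two_le_cos
    have hx2 : x ^ 2 ≤ 1 / 4 := by nlinarith [hx.2]
    have e1 := mul_le_mul_of_nonneg_left h2 (by positivity : 0 ≤ x + x ^ 3 / 3 + 2 / 3 * x ^ 5)
    have e2 := mul_le_mul_of_nonneg_left h3 (by positivity : 0 ≤ x ^ 2 + 10 / 3 * x ^ 4)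
    have e3 := mul_le_mul_of_nonneg_left hx2 (by positivity : 0 ≤ x ^ 4)
    nlinarith [e1, e2, e3]
  have hmono : MonotoneOn (fun s : ℝ => exp (s ^ 2 / 2 + s ^ 4 / 12 + s ^ 6 / 9) * cos s)
      (Set.Icc 0 (1 / 2)) := by
    refine monotoneOn_of_deriv_nonneg (convex_Icc _ _) (by fun_prop) (by fun_prop) fun x hx => ?_
    rw [interior_Icc] at hx
    have hd : HasDerivAt (fun s : ℝ => exp (s ^ 2 / 2 + s ^ 4 / 12 + s ^ 6 / 9) * cos s)
        (exp (x ^ 2 / 2 + x ^ 4 / 12 + x ^ 6 / 9) *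
          ((2 * x) / 2 + (4 * x ^ 3) / 12 + (6 * x ^ 5) / 9) * cos x +
          exp (x ^ 2 / 2 + x ^ 4 / 12 + x ^ 6 / 9) * (-sin x)) x :=
      HasDerivAt.congr_deriv ((((((hasDerivAt_pow 2 x).div_const 2).add
        ((hasDerivAt_pow 4 x).div_const 12)).add
        ((hasDerivAt_pow 6 x).div_const 9)).exp).mul (hasDerivAt_cos x)) (by simp)
    rw [hd.deriv]
    have h2 := hsin (Set.left_mem_Icc.2 (by positivity)) (Set.mem_Icc_of_Ioo hx) hx.1.le
    have h3 := exp_pos (x ^ 2 / 2 + x ^ 4 / 12 + x ^ 6 / 9)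
    have : 0 ≤ (x + x ^ 3 / 3 + 2 / 3 * x ^ 5) * cos x - sin x := by simpa using h2
    nlinarith [mul_nonneg h3.le this]
  have := hmono (Set.left_mem_Icc.2 (by positivity)) ⟨h0, h1⟩ h0
  rw [exp_neg, ← one_div, div_le_iff₀ (exp_pos _), mul_comm]
  simpa using this

theorem abs_cos_half_le_exp {u : ℝ} (h : |u| ≤ π) :
    |cos (u / 2)| ≤ exp (-(u ^ 2 / 8 + u ^ 4 / 192)) := by
  have h1 := cos_le_exp_of_nonneg (s := |u| / 2) (by positivity) (by linarith)
  have h2 : cos (u / 2) = cos (|u| / 2) := by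
    rw [← cos_abs (u / 2), abs_div, abs_two]
  have h3 : 0 ≤ cos (|u| / 2) := cos_nonneg_of_mem_Icc ⟨by linarith [abs_nonneg u, pi_pos], by linarith⟩
  rw [h2, abs_of_nonneg h3]
  refine h1.trans_eq ?_
  rw [div_pow, div_pow, sq_abs, show |u| ^ 4 = u ^ 4 from Even.pow_abs (by decide) u]
  ring_nf

theorem exp_le_abs_cos_half {u : ℝ} (h : |u| ≤ 1) :
    exp (-(u ^ 2 / 8 + u ^ 4 / 192 + u ^ 6 / 576)) ≤ |cos (u / 2)| := by
  have h1 := exp_le_cos_of_nonneg (s := |u| / 2) (by positivity) (by linarith)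
  have h2 : cos (u / 2) = cos (|u| / 2) := by
    rw [← cos_abs (u / 2), abs_div, abs_two]
  rw [h2]
  refine le_trans (le_of_eq ?_) (h1.trans (le_abs_self _))
  rw [div_pow, div_pow, div_pow, sq_abs, show |u| ^ 4 = u ^ 4 from Even.pow_abs (by decide) u,
    show |u| ^ 6 = u ^ 6 from Even.pow_abs (by decide) u]
  ring_nf

/-- No point `z` can be close to both `0` and a distant `a`. By product-to-sum the product is at
most `(|cos(a/2)| + 1)/2`, and `|cos(a/2)| ≤ √2/2 ≤ 3/4`. -/
theorem abs_cos_half_mul_abs_cos_half_le {a : ℝ} (h1 : π / 2 ≤ |a|) (h2 : |a| ≤ π) (z : ℝ) :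
    |cos (z / 2)| * |cos ((a - z) / 2)| ≤ 7 / 8 := by
  have hca : |cos (a / 2)| ≤ 3 / 4 := by
    have e : cos (a / 2) = cos (|a| / 2) := by rw [← cos_abs (a / 2), abs_div, abs_two]
    have h3 : 0 ≤ cos (|a| / 2) :=
      cos_nonneg_of_mem_Icc ⟨by linarith [abs_nonneg a, pi_pos], by linarith⟩
    rw [e, abs_of_nonneg h3]
    have h4 : cos (|a| / 2) ≤ cos (π / 4) :=
      cos_le_cos_of_nonneg_of_le_pi (by positivity) (by linarith [pi_pos]) (by linarith)
    rw [cos_pi_div_four] at h4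
    have : √2 ≤ 3 / 2 := by rw [Real.sqrt_le_left (by norm_num)]; norm_num
    linarith
  rw [← abs_mul]
  have e : cos (z / 2) * cos ((a - z) / 2) = (cos (a / 2) + cos (z - a / 2)) / 2 := by
    have e1 : a / 2 = z / 2 + (a - z) / 2 := by ring
    have e2 : z - a / 2 = z / 2 - (a - z) / 2 := by ring
    rw [e2, e1, cos_add, cos_sub]
    ring
  rw [e, abs_div, abs_two]
  have := abs_add_le (cos (a / 2)) (cos (z - a / 2))
  have := abs_cos_le_one (z - a / 2)
  linarith

/-! ### The interaction as a product of cosines -/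

/-- The interaction stripped of its power of two, as a symmetric double product. -/
noncomputable def kernel (β : ℝ) (n : ℕ) (θ : Fin n → ℝ) : ℝ :=
  ∏ j, ∏ k, |cos ((θ j - θ k) / 2)| ^ (β / 2)

theorem kernel_nonneg (β : ℝ) {n : ℕ} (θ : Fin n → ℝ) : 0 ≤ kernel β n θ :=
  Finset.prod_nonneg fun _ _ => Finset.prod_nonneg fun _ _ => by positivity

theorem continuous_kernel {β : ℝ} (hβ : 0 < β) (n : ℕ) : Continuous (kernel β n) := by
  refine continuous_finsetProd _ fun j _ => continuous_finsetProd _ fun k _ => ?_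
  exact Continuous.rpow_const (by fun_prop) fun _ => Or.inr (by positivity)

/-- Peels off one point. Each unordered pair occurs twice in the double product with exponent `β/2`,
and the diagonal factor is `1`. -/
theorem kernel_succAbove {β : ℝ} (hβ : 0 < β) (n : ℕ) (θ : Fin (n + 1) → ℝ) (i : Fin (n + 1)) :
    kernel β (n + 1) θ =
      (∏ j : Fin n, |cos ((θ i - θ (i.succAbove j)) / 2)| ^ β) *
        kernel β n (fun j => θ (i.succAbove j)) := by
  unfold kernel
  simp only [Fin.prod_univ_succAbove _ i, sub_self, zero_div, cos_zero, abs_one, one_rpow, one_mul,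
    Finset.prod_mul_distrib]
  rw [← mul_assoc, ← Finset.prod_mul_distrib]
  congr 1
  refine Finset.prod_congr rfl fun j _ => ?_
  rw [← neg_sub (θ i), neg_div, cos_neg, ← rpow_add' (abs_nonneg _) (by linarith), add_halves]

theorem norm_exp_add_exp (a b : ℝ) :
    ‖Complex.exp (Complex.I * a) + Complex.exp (Complex.I * b)‖ = 2 * |cos ((a - b) / 2)| := by
  have : Complex.exp (Complex.I * a) + Complex.exp (Complex.I * b) =
      Complex.exp (((a + b) / 2 : ℝ) * Complex.I) * (2 * Complex.cos (((a - b) / 2 : ℝ))) := by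
    rw [Complex.two_cos, mul_add, ← Complex.exp_add, ← Complex.exp_add]
    congr 2 <;> push_cast <;> ring
  rw [this, norm_mul, Complex.norm_exp_ofReal_mul_I, ← Complex.ofReal_cos, norm_mul,
    Complex.norm_real]
  simp

theorem interaction_eq {β : ℝ} (hβ : 0 < β) (n : ℕ) (θ : Fin n → ℝ) :
    interaction β n θ = 2 ^ (β * ((n : ℝ) * ((n : ℝ) - 1) / 2)) * kernel β n θ := by
  induction n with
  | zero => simp [interaction, kernel]
  | succ n ih =>
    have h := ih (fun j => θ j.succ)
    rw [kernel_succAbove hβ n θ 0]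
    unfold interaction at h ⊢
    rw [Fin.prod_univ_succ, Fin.prod_Ioi_zero]
    simp only [Fin.prod_Ioi_succ, Fin.zero_succAbove]
    rw [h]
    simp only [norm_exp_add_exp, mul_rpow zero_le_two (abs_nonneg _), Finset.prod_mul_distrib,
      Finset.prod_const, Finset.card_univ, Fintype.card_fin]
    rw [← rpow_natCast, ← rpow_mul zero_le_two]
    have : β * (((n + 1 : ℕ) : ℝ) * (((n + 1 : ℕ) : ℝ) - 1) / 2) =
      β * n + β * ((n : ℝ) * ((n : ℝ) - 1) / 2) := by push_cast; ring
    rw [this, rpow_add two_pos]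
    ring

/-! ### Differences of independent Gaussians -/

/-- The sum of the `p`-th powers of all pairwise differences. -/
def pairSum (p : ℕ) {n : ℕ} (x : Fin n → ℝ) : ℝ := ∑ j, ∑ k, (x j - x k) ^ p

theorem continuous_pairSum (p n : ℕ) : Continuous (pairSum p : (Fin n → ℝ) → ℝ) := by
  unfold pairSum; fun_prop

theorem pairSum_two {n : ℕ} (x : Fin n → ℝ) :
    pairSum 2 x = 2 * n * ∑ j, x j ^ 2 - 2 * (∑ j, x j) ^ 2 := by
  simp only [pairSum, sub_sq, Finset.sum_add_distrib, Finset.sum_sub_distrib, Finset.sum_const,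
    Finset.card_univ, Fintype.card_fin, nsmul_eq_mul, ← Finset.mul_sum, ← Finset.sum_mul]
  ring

/-- The law of `n` independent centred Gaussian variables of variance `v`. -/
noncomputable def iidGaussian (v : ℝ≥0) (n : ℕ) : Measure (Fin n → ℝ) :=
  Measure.pi fun _ => gaussianReal 0 v

instance (v : ℝ≥0) (n : ℕ) : IsProbabilityMeasure (iidGaussian v n) := by
  unfold iidGaussian; infer_instance

theorem iidGaussian_eq_withDensity {v : ℝ≥0} (hv : v ≠ 0) (n : ℕ) :
    iidGaussian v n =
      volume.withDensity fun x => ENNReal.ofReal (∏ i, gaussianPDFReal 0 v (x i)) := by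
  refine Measure.pi_eq fun s hs => ?_
  have hnn : ∀ x : Fin n → ℝ, 0 ≤ ∏ i, gaussianPDFReal 0 v (x i) := fun x =>
    Finset.prod_nonneg fun i _ => gaussianPDFReal_nonneg _ _ _
  have hi : Integrable fun x : Fin n → ℝ => ∏ i, gaussianPDFReal 0 v (x i) :=
    Integrable.fintype_prod fun i => integrable_gaussianPDFReal 0 v
  rw [withDensity_apply _ (MeasurableSet.univ_pi hs), ← ofReal_integral_eq_lintegral_ofReal
    hi.integrableOn (ae_of_all _ hnn), volume_pi, Measure.restrict_pi_pi, integral_fintype_prod_eq_prod,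
    ENNReal.ofReal_prod_of_nonneg fun i _ =>
      integral_nonneg fun x => gaussianPDFReal_nonneg _ _ _]
  exact Finset.prod_congr rfl fun i _ => (gaussianReal_apply_eq_integral 0 hv _).symm

/-- Completing the square in `a` leaves the empirical variance of the points `0, y_1, …, y_m`, which
by `pairSum_two` is a multiple of `pairSum 2`. -/
theorem lintegral_gaussianPDF_common_shift {v : ℝ≥0} (hv : v ≠ 0) {m : ℕ} (y : Fin m → ℝ) :
    ∫⁻ a, ENNReal.ofReal (gaussianPDFReal 0 v a * ∏ j, gaussianPDFReal 0 v (y j + a)) =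
      ENNReal.ofReal ((√(2 * π * v) ^ m * √(m + 1))⁻¹ *
        exp (-(pairSum 2 (Fin.cons 0 y : Fin (m + 1) → ℝ) / (4 * v * (m + 1))))) := by
  have hv' : (0 : ℝ) < v := NNReal.coe_pos.2 (pos_iff_ne_zero.2 hv)
  have hm : (0 : ℝ) < m + 1 := by positivity
  have hs : 0 < √(2 * π * v) := sqrt_pos.2 (by positivity)
  set S := ∑ j, y j with hS
  set E := exp (-(pairSum 2 (Fin.cons 0 y : Fin (m + 1) → ℝ) / (4 * v * (m + 1)))) with hE
  have key : ∀ a : ℝ, gaussianPDFReal 0 v a * ∏ j, gaussianPDFReal 0 v (y j + a) =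
      (√(2 * π * v))⁻¹ ^ (m + 1) * E * exp (-((m + 1) / (2 * v)) * (a + S / (m + 1)) ^ 2) := by
    intro a
    simp only [gaussianPDFReal_def, sub_zero, Finset.prod_mul_distrib, Finset.prod_const,
      Finset.card_univ, Fintype.card_fin, ← exp_sum]
    rw [mul_mul_mul_comm, ← pow_succ', mul_assoc _ E, hE, ← exp_add, ← exp_add, pairSum_two]
    congr 2
    simp only [Fin.sum_univ_succ, Fin.cons_zero, Fin.cons_succ, neg_div, Finset.sum_neg_distrib,
      ← Finset.sum_div, add_sq, Finset.sum_add_distrib, ← Finset.mul_sum, ← Finset.sum_mul,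
      Finset.sum_const, Finset.card_univ, Fintype.card_fin, nsmul_eq_mul, ← hS]
    push_cast
    field_simp
    ring
  have hint : ∫ a, exp (-((m + 1) / (2 * (v : ℝ))) * (a + S / (m + 1)) ^ 2) =
      √(2 * π * v) / √(m + 1) := by
    rw [integral_add_right_eq_self fun a => exp (-((m + 1) / (2 * (v : ℝ))) * a ^ 2),
      integral_gaussian, ← sqrt_div' _ hm.le]
    congr 1
    field_simp
  have hi : Integrable fun a => exp (-((m + 1) / (2 * (v : ℝ))) * (a + S / (m + 1)) ^ 2) :=
    (integrable_exp_neg_mul_sq (by positivity)).comp_add_right (S / (m + 1))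
  simp only [key]
  rw [← ofReal_integral_eq_lintegral_ofReal (hi.const_mul _)
    (ae_of_all _ fun a => by positivity), integral_const_mul, hint]
  congr 1
  rw [pow_succ, inv_pow]
  field_simp

/-- The differences to the first of `m + 1` independent Gaussian variables have a Gaussian law
whose exponent is the sum of all squared differences. -/
theorem lintegral_iidGaussian_sub_zero {v : ℝ≥0} (hv : v ≠ 0) {m : ℕ}
    {h : (Fin m → ℝ) → ℝ≥0∞} (hh : Measurable h) :
    ∫⁻ x, h (fun j => x j.succ - x 0) ∂iidGaussian v (m + 1) =
      ∫⁻ y, h y * ENNReal.ofReal ((√(2 * π * v) ^ m * √(m + 1))⁻¹ *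
        exp (-(pairSum 2 (Fin.cons 0 y : Fin (m + 1) → ℝ) / (4 * v * (m + 1))))) := by
  have hp : Measurable (gaussianPDFReal 0 v) := measurable_gaussianPDFReal 0 v
  have hT : Measurable fun x : Fin (m + 1) → ℝ => h (fun j => x j.succ - x 0) :=
    hh.comp (by fun_prop)
  rw [iidGaussian_eq_withDensity hv, lintegral_withDensity_eq_lintegral_mul _ (by fun_prop) hT,
    ← (volume_preserving_piFinSuccAbove (fun _ : Fin (m + 1) => ℝ) 0).symm.lintegral_comp_emb
      (MeasurableEquiv.measurableEmbedding _), Measure.volume_eq_prod]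
  have e : ∀ p : ℝ × (Fin m → ℝ),
      (MeasurableEquiv.piFinSuccAbove (fun _ : Fin (m + 1) => ℝ) 0).symm p =
        (Fin.cons p.1 p.2 : Fin (m + 1) → ℝ) := fun p => by
    simp [MeasurableEquiv.piFinSuccAbove, Fin.insertNthEquiv]
  simp only [e, Pi.mul_apply, Fin.prod_univ_succ, Fin.cons_zero, Fin.cons_succ]
  have hm1 : Measurable fun p : ℝ × (Fin m → ℝ) => ENNReal.ofReal
      (gaussianPDFReal 0 v p.1 * ∏ j, gaussianPDFReal 0 v (p.2 j)) := by fun_prop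
  have hm2 : Measurable fun p : ℝ × (Fin m → ℝ) => h (fun j => p.2 j - p.1) :=
    hh.comp (by fun_prop)
  have hm3 : Measurable fun p : ℝ × (Fin m → ℝ) => ENNReal.ofReal
      (gaussianPDFReal 0 v p.1 * ∏ j, gaussianPDFReal 0 v (p.2 j)) * h (fun j => p.2 j - p.1) :=
    hm1.mul hm2
  rw [lintegral_prod _ hm3.aemeasurable]
  have hshift : ∀ a : ℝ, ∫⁻ z : Fin m → ℝ, ENNReal.ofReal
      (gaussianPDFReal 0 v a * ∏ j, gaussianPDFReal 0 v (z j)) * h (fun j => z j - a) =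
      ∫⁻ y : Fin m → ℝ, h y * ENNReal.ofReal
        (gaussianPDFReal 0 v a * ∏ j, gaussianPDFReal 0 v (y j + a)) := by
    intro a
    rw [← lintegral_add_right_eq_self _ (fun _ => a : Fin m → ℝ)]
    refine lintegral_congr fun y => ?_
    simp only [Pi.add_apply, add_sub_cancel_right]
    rw [mul_comm]
  simp only [hshift]
  rw [lintegral_lintegral_swap]
  · refine lintegral_congr fun y => ?_
    rw [lintegral_const_mul _ (by fun_prop), lintegral_gaussianPDF_common_shift hv]
  · refine Measurable.aemeasurable ?_
    exact (hh.comp measurable_snd).mul (by fun_prop)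

/-! ### Moments of pair sums -/

/-- The moments of the standard Gaussian law. -/
noncomputable def gaussianMoment (p : ℕ) : ℝ := ∫ x, x ^ p ∂gaussianReal 0 1

theorem integrable_pow_gaussianReal (μ : ℝ) (v : ℝ≥0) (p : ℕ) :
    Integrable (fun x : ℝ => x ^ p) (gaussianReal μ v) := by
  have h := (memLp_id_gaussianReal (μ := μ) (v := v) p).integrable_norm_pow'
  refine (integrable_norm_iff (by fun_prop)).1 ?_
  simpa only [norm_pow, id] using h

theorem integral_pow_gaussianReal (v : ℝ≥0) (p : ℕ) :
    ∫ x, x ^ p ∂gaussianReal 0 v = √(v : ℝ) ^ p * gaussianMoment p := by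
  have h := gaussianReal_map_const_mul (μ := 0) (v := 1) √(v : ℝ)
  have e : NNReal.mk (√(v : ℝ) ^ 2) (sq_nonneg _) * 1 = v := by
    ext; simp
  rw [mul_zero, e] at h
  rw [← h, integral_map (by fun_prop) (by fun_prop)]
  simp only [mul_pow, integral_const_mul, gaussianMoment]

theorem gaussianMoment_two : gaussianMoment 2 = 1 := by
  have h := variance_fun_id_gaussianReal (μ := 0) (v := 1)
  rw [variance_eq_integral (by fun_prop)] at h
  simpa [gaussianMoment] using h

theorem gaussianMoment_four : gaussianMoment 4 = 3 := by
  have h1 : ∀ x : ℝ, gaussianPDFReal 0 1 x • x ^ 4 =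
      (√(2 * π))⁻¹ * (fun y : ℝ => y ^ (4 : ℝ) * exp (-(1 / 2) * y ^ (2 : ℝ))) |x| := by
    intro x
    have e1 : |x| ^ (4 : ℝ) = x ^ 4 := by
      rw [show (4 : ℝ) = ((4 : ℕ) : ℝ) by norm_num, rpow_natCast, Even.pow_abs (by decide)]
    have e2 : |x| ^ (2 : ℝ) = x ^ 2 := by
      rw [show (2 : ℝ) = ((2 : ℕ) : ℝ) by norm_num, rpow_natCast, Even.pow_abs (by decide)]
    simp only [e1, e2, gaussianPDFReal_def, smul_eq_mul, NNReal.coe_one, sub_zero, mul_one]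
    ring_nf
  have hG : Gamma ((4 + 1) / 2) = 3 / 4 * √π := by
    have := Real.Gamma_nat_add_half 2
    norm_num at this ⊢
    rw [this]
    ring
  rw [gaussianMoment, integral_gaussianReal_eq_integral_smul one_ne_zero]
  simp only [h1]
  rw [integral_const_mul, integral_comp_abs (f := fun y : ℝ => y ^ (4 : ℝ) *
    exp (-(1 / 2) * y ^ (2 : ℝ))), integral_rpow_mul_exp_neg_mul_rpow two_pos (by norm_num)
    (by norm_num), hG, sqrt_mul zero_le_two]
  have e : (1 / 2 : ℝ) ^ (-(4 + 1) / 2 : ℝ) = 4 * √2 := by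
    rw [one_div, inv_rpow zero_le_two, ← rpow_neg zero_le_two,
      show (-(-(4 + 1) / 2) : ℝ) = 2 + 1 / 2 by norm_num, rpow_add two_pos, ← sqrt_eq_rpow]
    norm_num
  rw [e]
  have : 0 < √π := sqrt_pos.2 pi_pos
  field_simp

theorem gaussianMoment_nonneg {p : ℕ} (hp : Even p) : 0 ≤ gaussianMoment p :=
  integral_nonneg fun _ => hp.pow_nonneg _

variable {v : ℝ≥0} {n : ℕ}

theorem iIndepFun_iidGaussian (v : ℝ≥0) (n : ℕ) :
    iIndepFun (fun (i : Fin n) (x : Fin n → ℝ) => x i) (iidGaussian v n) :=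
  iIndepFun_pi (X := fun _ x => x) fun _ => by fun_prop

theorem map_eval_iidGaussian (i : Fin n) :
    (iidGaussian v n).map (fun x => x i) = gaussianReal 0 v :=
  (measurePreserving_eval (fun _ : Fin n => gaussianReal 0 v) i).map_eq

theorem map_sub_iidGaussian {j k : Fin n} (h : j ≠ k) :
    (iidGaussian v n).map (fun x => x j - x k) = gaussianReal 0 (2 * v) := by
  have hind := (iIndepFun_iidGaussian v n).indepFun h
  have hneg : (iidGaussian v n).map (fun x => -x k) = gaussianReal 0 v := by
    have := gaussianReal_map_neg (μ := 0) (v := v)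
    rw [neg_zero, ← map_eval_iidGaussian k, Measure.map_map (by fun_prop) (by fun_prop)] at this
    rw [← map_eval_iidGaussian k]
    exact this
  have h2 := gaussianReal_add_gaussianReal_of_indepFun
    (hind.comp (φ := id) (ψ := fun y => -y) measurable_id (by fun_prop))
    (map_eval_iidGaussian j) hneg
  rw [add_zero, ← two_mul] at h2
  exact h2

theorem integrable_sub_pow (p : ℕ) (j k : Fin n) :
    Integrable (fun x => (x j - x k) ^ p) (iidGaussian v n) := by
  rcases eq_or_ne j k with rfl | h
  · simp only [sub_self]; exact integrable_const _
  · have := integrable_pow_gaussianReal 0 (2 * v) p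
    rw [← map_sub_iidGaussian h] at this
    exact this.comp_measurable (f := fun x : Fin n → ℝ => x j - x k) (by fun_prop)

theorem integral_sub_pow (p : ℕ) {j k : Fin n} (h : j ≠ k) :
    ∫ x, (x j - x k) ^ p ∂iidGaussian v n = √(2 * v : ℝ) ^ p * gaussianMoment p := by
  have := integral_pow_gaussianReal (2 * v) p
  rw [← map_sub_iidGaussian h, integral_map (by fun_prop) (by fun_prop)] at this
  exact_mod_cast this

theorem integral_sub_pow_le {p : ℕ} (hp : Even p) (hp0 : p ≠ 0) (j k : Fin n) :
    ∫ x, (x j - x k) ^ p ∂iidGaussian v n ≤ √(2 * v : ℝ) ^ p * gaussianMoment p := by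
  rcases eq_or_ne j k with rfl | h
  · simp only [sub_self, zero_pow hp0, integral_zero]
    exact mul_nonneg (by positivity) (gaussianMoment_nonneg hp)
  · exact (integral_sub_pow p h).le

theorem integrable_pairSum (p : ℕ) : Integrable (pairSum p) (iidGaussian v n) :=
  integrable_finsetSum _ fun _ _ => integrable_finsetSum _ fun _ _ => integrable_sub_pow p _ _

theorem integral_pairSum_le {p : ℕ} (hp : Even p) (hp0 : p ≠ 0) :
    ∫ x, pairSum p x ∂iidGaussian v n ≤ (n : ℝ) ^ 2 * (√(2 * v : ℝ) ^ p * gaussianMoment p) := by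
  unfold pairSum
  rw [integral_finsetSum _ fun _ _ => integrable_finsetSum _ fun _ _ => integrable_sub_pow p _ _]
  have h : ∀ j : Fin n, ∫ x, ∑ k, (x j - x k) ^ p ∂iidGaussian v n ≤
      n * (√(2 * v : ℝ) ^ p * gaussianMoment p) := fun j => by
    rw [integral_finsetSum _ fun _ _ => integrable_sub_pow p _ _]
    simpa using Finset.sum_le_sum fun k (_ : k ∈ Finset.univ) =>
      integral_sub_pow_le (v := v) hp hp0 j k
  have := Finset.sum_le_sum fun k (_ : k ∈ Finset.univ) => h k
  simp only [Finset.sum_const, Finset.card_univ, Fintype.card_fin, nsmul_eq_mul] at this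
  linarith

theorem integral_pairSum {p : ℕ} (hp0 : p ≠ 0) :
    ∫ x, pairSum p x ∂iidGaussian v n =
      n * ((n - 1) * (√(2 * v : ℝ) ^ p * gaussianMoment p)) := by
  unfold pairSum
  rw [integral_finsetSum _ fun _ _ => integrable_finsetSum _ fun _ _ => integrable_sub_pow p _ _]
  have h : ∀ j : Fin n, ∫ x, ∑ k, (x j - x k) ^ p ∂iidGaussian v n =
      (n - 1) * (√(2 * v : ℝ) ^ p * gaussianMoment p) := fun j => by
    rw [integral_finsetSum _ fun _ _ => integrable_sub_pow p _ _,
      ← Finset.add_sum_erase _ _ (Finset.mem_univ j),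
      Finset.sum_congr rfl fun k hk => integral_sub_pow p (Finset.ne_of_mem_erase hk).symm]
    have : 1 ≤ n := j.pos
    simp [hp0, Finset.card_erase_of_mem, Nat.cast_sub this]
  simp [h]

theorem integrable_sub_pow_mul_sub_pow (p : ℕ) (j k l m : Fin n) :
    Integrable (fun x => (x j - x k) ^ p * (x l - x m) ^ p) (iidGaussian v n) := by
  have h1 := integrable_sub_pow (v := v) (2 * p) j k
  have h2 := integrable_sub_pow (v := v) (2 * p) l m
  refine (h1.add h2).mono' (by fun_prop) (ae_of_all _ fun x => ?_)
  rw [norm_eq_abs, abs_mul]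
  simp only [Pi.add_apply, mul_comm 2 p, pow_mul]
  rw [← sq_abs ((x j - x k) ^ p), ← sq_abs ((x l - x m) ^ p)]
  nlinarith [sq_nonneg (|(x j - x k) ^ p| - |(x l - x m) ^ p|),
    sq_nonneg (|(x j - x k) ^ p| + |(x l - x m) ^ p|)]

/-- Disjoint index pairs are independent; overlapping ones are controlled by the
arithmetic-geometric mean inequality. The indicators count coincidences, so summing over quadruples
adds only `4n³` error terms to the main `n⁴`. -/
theorem integral_sub_pow_mul_sub_pow_le (p : ℕ) (hp : Even p) (hp0 : p ≠ 0) (j k l m : Fin n) :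
    ∫ x, (x j - x k) ^ p * (x l - x m) ^ p ∂iidGaussian v n ≤
      (√(2 * v : ℝ) ^ p * gaussianMoment p) ^ 2 +
      ((if j = l then 1 else 0) + (if j = m then 1 else 0) + (if k = l then 1 else 0) +
        (if k = m then 1 else 0)) * (√(2 * v : ℝ) ^ (2 * p) * gaussianMoment (2 * p)) := by
  have hM := mul_nonneg (pow_nonneg (sqrt_nonneg (2 * v : ℝ)) (2 * p))
    (gaussianMoment_nonneg (even_two_mul p))
  set B := √(2 * v : ℝ) ^ (2 * p) * gaussianMoment (2 * p)
  by_cases hdis : j ≠ l ∧ j ≠ m ∧ k ≠ l ∧ k ≠ m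
  · obtain ⟨h1, h2, h3, h4⟩ := hdis
    have hind := (iIndepFun_iidGaussian v n).indepFun_prodMk_prodMk (fun i => by fun_prop)
      j k l m h1 h2 h3 h4
    rw [hind.integral_fun_comp_mul_comp (f := fun z => (z.1 - z.2) ^ p)
      (g := fun z => (z.1 - z.2) ^ p) (by fun_prop) (by fun_prop) (by fun_prop) (by fun_prop)]
    simp only [h1, h2, h3, h4, if_false, add_zero, zero_mul, sq]
    exact mul_le_mul (integral_sub_pow_le hp hp0 j k) (integral_sub_pow_le hp hp0 l m)
      (integral_nonneg fun _ => hp.pow_nonneg _)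
      (mul_nonneg (by positivity) (gaussianMoment_nonneg hp))
  · have h1 : ∫ x, (x j - x k) ^ p * (x l - x m) ^ p ∂iidGaussian v n ≤
        ∫ x, ((x j - x k) ^ (2 * p) + (x l - x m) ^ (2 * p)) / 2 ∂iidGaussian v n := by
      refine integral_mono (integrable_sub_pow_mul_sub_pow p j k l m)
        (((integrable_sub_pow _ j k).add (integrable_sub_pow _ l m)).div_const 2) fun x => ?_
      simp only [mul_comm 2 p, pow_mul]
      nlinarith [sq_nonneg ((x j - x k) ^ p - (x l - x m) ^ p)]
    rw [integral_div, integral_add (integrable_sub_pow _ j k) (integrable_sub_pow _ l m)] at h1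
    have h2 := integral_sub_pow_le (v := v) (even_two_mul p) (by omega) j k
    have h3 := integral_sub_pow_le (v := v) (even_two_mul p) (by omega) l m
    -- Some indices coincide here, so the bracket of indicators is at least one.
    have h4 : (1 : ℝ) ≤ (if j = l then 1 else 0) + (if j = m then 1 else 0) +
        (if k = l then 1 else 0) + (if k = m then 1 else 0) := by
      by_contra hlt
      apply hdis
      refine ⟨?_, ?_, ?_, ?_⟩ <;> intro he <;> apply hlt <;> rw [if_pos he] <;>
        split_ifs <;> norm_num
    nlinarith [mul_le_mul_of_nonneg_right h4 hM, sq_nonneg (√(2 * v : ℝ) ^ p * gaussianMoment p)]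

theorem pairSum_sq (p : ℕ) (x : Fin n → ℝ) :
    pairSum p x ^ 2 = ∑ j, ∑ k, ∑ l, ∑ m, (x j - x k) ^ p * (x l - x m) ^ p := by
  simp only [pairSum, sq, Finset.sum_mul]
  simp only [Finset.mul_sum]

theorem integrable_pairSum_sq (p : ℕ) :
    Integrable (fun x => pairSum p x ^ 2) (iidGaussian v n) := by
  simp only [pairSum_sq]
  exact integrable_finsetSum _ fun _ _ => integrable_finsetSum _ fun _ _ =>
    integrable_finsetSum _ fun _ _ => integrable_finsetSum _ fun _ _ =>
      integrable_sub_pow_mul_sub_pow p _ _ _ _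

theorem integral_pairSum_sq_le {p : ℕ} (hp : Even p) (hp0 : p ≠ 0) :
    ∫ x, pairSum p x ^ 2 ∂iidGaussian v n ≤
      (n : ℝ) ^ 4 * (√(2 * v : ℝ) ^ p * gaussianMoment p) ^ 2 +
        4 * n ^ 3 * (√(2 * v : ℝ) ^ (2 * p) * gaussianMoment (2 * p)) := by
  have hi := integrable_sub_pow_mul_sub_pow (v := v) (n := n) p
  simp only [pairSum_sq]
  rw [integral_finsetSum _ fun _ _ => integrable_finsetSum _ fun _ _ =>
    integrable_finsetSum _ fun _ _ => integrable_finsetSum _ fun _ _ => hi _ _ _ _]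
  simp_rw [integral_finsetSum Finset.univ fun _ _ => integrable_finsetSum _ fun _ _ =>
    integrable_finsetSum _ fun _ _ => hi _ _ _ _,
    integral_finsetSum Finset.univ fun _ _ => integrable_finsetSum _ fun _ _ => hi _ _ _ _,
    integral_finsetSum Finset.univ fun _ _ => hi _ _ _ _]
  refine (Finset.sum_le_sum fun j _ => Finset.sum_le_sum fun k _ => Finset.sum_le_sum fun l _ =>
    Finset.sum_le_sum fun m _ => integral_sub_pow_mul_sub_pow_le p hp hp0 j k l m).trans_eq ?_
  simp only [Finset.sum_add_distrib, ← Finset.sum_mul, Finset.sum_ite_eq, Finset.mem_univ,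
    Finset.sum_const, Finset.card_univ, Fintype.card_fin, nsmul_eq_mul, if_true]
  simp
  ring

/-! ### The Gaussian weight as a probability law -/

theorem pairSum_add_const (p : ℕ) {n : ℕ} (x : Fin n → ℝ) (a : ℝ) :
    pairSum p (fun j => x j + a) = pairSum p x := by
  simp [pairSum]

theorem pairSum_cons_sub (p : ℕ) {m : ℕ} (x : Fin (m + 1) → ℝ) :
    pairSum p (Fin.cons 0 (fun j => x j.succ - x 0) : Fin (m + 1) → ℝ) = pairSum p x := by
  rw [← pairSum_add_const p x (-x 0)]
  congr 1
  ext j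
  refine Fin.cases ?_ (fun j => ?_) j <;> simp [sub_eq_add_neg]

theorem pairSum_nonneg {p : ℕ} (hp : Even p) {n : ℕ} (x : Fin n → ℝ) : 0 ≤ pairSum p x :=
  Finset.sum_nonneg fun _ _ => Finset.sum_nonneg fun _ _ => hp.pow_nonneg _

/-- The Gaussian weight that approximates the interaction near the diagonal. -/
noncomputable def gaussianWeight (β : ℝ) {m : ℕ} (y : Fin m → ℝ) : ℝ :=
  exp (-(β / 16 * pairSum 2 (Fin.cons 0 y : Fin (m + 1) → ℝ)))

/-- The variance of the independent variables representing `gaussianWeight`. -/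
noncomputable def siteVariance (β : ℝ) (n : ℕ) : ℝ≥0 := (4 / (β * n)).toNNReal

/-- The total mass of `gaussianWeight` on `ℝ ^ m`. -/
noncomputable def gaussianMass (β : ℝ) (m : ℕ) : ℝ :=
  √(8 * π / (β * (m + 1))) ^ m * √(m + 1)

theorem gaussianMass_pos {β : ℝ} (hβ : 0 < β) (m : ℕ) : 0 < gaussianMass β m := by
  unfold gaussianMass; positivity

theorem coe_siteVariance {β : ℝ} (hβ : 0 < β) (n : ℕ) : (siteVariance β n : ℝ) = 4 / (β * n) :=
  coe_toNNReal _ (by positivity)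

theorem siteVariance_ne_zero {β : ℝ} (hβ : 0 < β) (m : ℕ) : siteVariance β (m + 1) ≠ 0 := by
  rw [← NNReal.coe_ne_zero, coe_siteVariance hβ]
  positivity

theorem continuous_finCons (a : ℝ) (m : ℕ) :
    Continuous fun y : Fin m → ℝ => (Fin.cons a y : Fin (m + 1) → ℝ) := by
  refine continuous_pi fun j => Fin.cases ?_ (fun j => ?_) j
  · simpa using continuous_const
  · simpa using continuous_apply j

theorem continuous_gaussianWeight (β : ℝ) (m : ℕ) :
    Continuous (gaussianWeight β : (Fin m → ℝ) → ℝ) := by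
  have := (continuous_pairSum 2 (m + 1)).comp (continuous_finCons 0 m)
  unfold gaussianWeight
  exact (continuous_const.mul this).neg.rexp

/-- The variance `4/(βn)` is what makes `1/(4vn)` equal to `β/16`. Integrals against the weight over
`ℝ^m` thereby become expectations over `m + 1` exchangeable variables. -/
theorem map_iidGaussian_sub_zero {β : ℝ} (hβ : 0 < β) (m : ℕ) :
    (iidGaussian (siteVariance β (m + 1)) (m + 1)).map (fun x (j : Fin m) => x j.succ - x 0) =
      volume.withDensity fun y => ENNReal.ofReal ((gaussianMass β m)⁻¹ * gaussianWeight β y) := by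
  have hw := (continuous_gaussianWeight β m).measurable
  refine Measure.ext_of_lintegral _ fun h hh => ?_
  rw [lintegral_map hh (by fun_prop), lintegral_withDensity_eq_lintegral_mul _ (by fun_prop) hh,
    lintegral_iidGaussian_sub_zero (siteVariance_ne_zero hβ m) hh]
  refine lintegral_congr fun y => ?_
  rw [Pi.mul_apply, mul_comm, coe_siteVariance hβ, gaussianMass, gaussianWeight]
  have e1 : 2 * π * (4 / (β * ((m + 1 : ℕ) : ℝ))) = 8 * π / (β * (m + 1)) := by
    push_cast; ring
  have e2 : pairSum 2 (Fin.cons 0 y : Fin (m + 1) → ℝ) /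
      (4 * (4 / (β * ((m + 1 : ℕ) : ℝ))) * (m + 1)) =
      β / 16 * pairSum 2 (Fin.cons 0 y : Fin (m + 1) → ℝ) := by
    push_cast; field_simp; ring
  rw [e1, e2]

theorem integrable_mul_gaussianWeight {β : ℝ} (hβ : 0 < β) {m : ℕ} {H : (Fin m → ℝ) → ℝ}
    (hH : Measurable H) (hi : Integrable (fun x => H (fun j => x j.succ - x 0))
      (iidGaussian (siteVariance β (m + 1)) (m + 1))) :
    Integrable fun y => gaussianWeight β y * H y := by
  have hw := (continuous_gaussianWeight β m).measurable
  have h1 : Integrable H ((iidGaussian (siteVariance β (m + 1)) (m + 1)).map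
      (fun x (j : Fin m) => x j.succ - x 0)) :=
    (integrable_map_measure hH.aestronglyMeasurable (by fun_prop)).2 hi
  rw [map_iidGaussian_sub_zero hβ, integrable_withDensity_iff_integrable_smul' (by fun_prop)
    (by simp)] at h1
  have h2 := h1.const_mul (gaussianMass β m)
  refine h2.congr (ae_of_all _ fun y => ?_)
  have hm := gaussianMass_pos hβ m
  have : 0 ≤ gaussianWeight β y := (exp_pos _).le
  simp only [smul_eq_mul]
  rw [ENNReal.toReal_ofReal (by positivity)]
  field_simp

theorem integral_gaussianWeight_mul {β : ℝ} (hβ : 0 < β) {m : ℕ} {H : (Fin m → ℝ) → ℝ}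
    (hH : Measurable H) :
    ∫ y, gaussianWeight β y * H y = gaussianMass β m *
      ∫ x, H (fun j => x j.succ - x 0) ∂iidGaussian (siteVariance β (m + 1)) (m + 1) := by
  have hw := (continuous_gaussianWeight β m).measurable
  rw [← integral_map (φ := fun (x : Fin (m + 1) → ℝ) (j : Fin m) => x j.succ - x 0) (by fun_prop)
    hH.aestronglyMeasurable, map_iidGaussian_sub_zero hβ,
    integral_withDensity_eq_integral_toReal_smul (by fun_prop) (by simp), ← integral_const_mul]
  refine integral_congr_ae (ae_of_all _ fun y => ?_)
  have hm := gaussianMass_pos hβ m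
  have : 0 ≤ gaussianWeight β y := (exp_pos _).le
  simp only [smul_eq_mul]
  rw [ENNReal.toReal_ofReal (by positivity)]
  field_simp

theorem sqrt_two_mul_siteVariance_sq {β : ℝ} (hβ : 0 < β) (n : ℕ) :
    √(2 * siteVariance β n : ℝ) ^ 2 = 8 / (β * n) := by
  rw [sq_sqrt (by positivity), coe_siteVariance hβ]
  ring

/-! ### The exponential of the quartic correction -/

/-- A second-order upper bound valid for all `t ≥ 0`, not only near `a`: when `|t - a| > 1` the
square already dominates. Taking expectations then needs only the mean and second moment. -/
theorem exp_neg_le_of_nonneg {a t : ℝ} (ha : 0 ≤ a) (ht : 0 ≤ t) :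
    exp (-t) ≤ exp (-a) * (1 - (t - a)) + (t - a) ^ 2 := by
  have h1 : exp (-t) ≤ 1 := exp_le_one_iff.2 (by linarith)
  have h2 : exp (-a) ≤ 1 := exp_le_one_iff.2 (by linarith)
  have h3 := exp_pos (-a)
  rcases le_or_gt |t - a| 1 with h | h
  · have h4 := abs_exp_sub_one_sub_id_le (x := -(t - a)) (by rwa [abs_neg])
    have h5 : exp (-t) = exp (-a) * exp (-(t - a)) := by rw [← exp_add]; ring_nf
    have h6 := (abs_le.1 h4).2
    rw [h5]
    nlinarith [mul_le_mul_of_nonneg_left h6 h3.le, sq_nonneg (t - a),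
      mul_le_mul_of_nonneg_right h2 (sq_nonneg (t - a))]
  · rcases lt_abs.1 h with h' | h'
    · nlinarith [mul_le_mul_of_nonneg_right h2 (by linarith : 0 ≤ t - a - 1), add_one_le_exp (-t)]
    · nlinarith [mul_pos h3 (by linarith : 0 < 1 - (t - a))]

/-- The mean of the exponential of the quartic correction. -/
theorem integral_exp_neg_pairSum_four {β : ℝ} (hβ : 0 < β) :
    ∃ C : ℝ, ∀ n : ℕ, 1 ≤ n →
      |∫ x, exp (-(β / 384 * pairSum 4 x)) ∂iidGaussian (siteVariance β n) n -
        exp (-(1 / (2 * β)))| ≤ C / n := by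
  -- With `a = 1/(2β)`, the terms are `a` from the mean `a - a/n`, then `2a²` from centring the
  -- square at `a` instead of the mean, then the overlapping quadruples.
  refine ⟨1 / (2 * β) + 1 / (2 * β ^ 2) + gaussianMoment 8 / (9 * β ^ 2), fun n hn => ?_⟩
  have hn' : (0 : ℝ) < n := by exact_mod_cast hn
  set P := iidGaussian (siteVariance β n) n
  set a := 1 / (2 * β) with ha
  have ha0 : 0 < a := by positivity
  have hQ0 : ∀ x : Fin n → ℝ, 0 ≤ β / 384 * pairSum 4 x := fun x =>
    mul_nonneg (by positivity) (pairSum_nonneg (by decide) x)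
  have hQi : Integrable (fun x : Fin n → ℝ => β / 384 * pairSum 4 x) P :=
    (integrable_pairSum 4).const_mul _
  have hQ2i : Integrable (fun x : Fin n → ℝ => (β / 384 * pairSum 4 x) ^ 2) P := by
    simp only [mul_pow]; exact (integrable_pairSum_sq 4).const_mul _
  have hEi : Integrable (fun x : Fin n → ℝ => exp (-(β / 384 * pairSum 4 x))) P := by
    refine (integrable_const (1 : ℝ)).mono' ?_ (ae_of_all _ fun x => ?_)
    · exact (continuous_const.mul (continuous_pairSum 4 n)).neg.rexp.aestronglyMeasurable
    · rw [norm_eq_abs, abs_exp]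
      exact exp_le_one_iff.2 (by linarith [hQ0 x])
  have hs2 := sqrt_two_mul_siteVariance_sq hβ n
  have hs4 : √(2 * siteVariance β n : ℝ) ^ 4 = (8 / (β * n)) ^ 2 := by rw [← hs2]; ring
  have hs8 : √(2 * siteVariance β n : ℝ) ^ 8 = (8 / (β * n)) ^ 4 := by rw [← hs2]; ring
  have hEQ : ∫ x, β / 384 * pairSum 4 x ∂P = a - a / n := by
    rw [integral_const_mul, integral_pairSum (by norm_num), gaussianMoment_four, hs4, ha]
    field_simp
    ring
  have hEQ2 : ∫ x, (β / 384 * pairSum 4 x) ^ 2 ∂P ≤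
      a ^ 2 + gaussianMoment 8 / (9 * β ^ 2) / n := by
    simp only [mul_pow]
    rw [integral_const_mul]
    refine (mul_le_mul_of_nonneg_left (integral_pairSum_sq_le (by decide) (by norm_num))
      (by positivity)).trans_eq ?_
    rw [gaussianMoment_four, show 2 * 4 = 8 from rfl, hs4, hs8, ha]
    field_simp
    ring
  -- Convexity: the tangent line at `a` lies below, and the mean does not exceed `a`, so no error
  -- term appears.
  have hlow : exp (-a) ≤ ∫ x, exp (-(β / 384 * pairSum 4 x)) ∂P := by
    have h1 : ∫ x, exp (-a) * (1 + a - β / 384 * pairSum 4 x) ∂P ≤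
        ∫ x, exp (-(β / 384 * pairSum 4 x)) ∂P := by
      refine integral_mono (((integrable_const _).sub hQi).const_mul _) hEi fun x => ?_
      have h5 : exp (-(β / 384 * pairSum 4 x)) = exp (-a) * exp (a - β / 384 * pairSum 4 x) := by
        rw [← exp_add]; ring_nf
      simp only [h5]
      exact mul_le_mul_of_nonneg_left (by linarith [add_one_le_exp (a - β / 384 * pairSum 4 x)])
        (exp_pos _).le
    rw [integral_const_mul, integral_sub (integrable_const _) hQi, hEQ, integral_const] at h1
    simp only [probReal_univ, one_smul] at h1
    have : 0 < a / n := by positivity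
    nlinarith [exp_pos (-a)]
  have hup : ∫ x, exp (-(β / 384 * pairSum 4 x)) ∂P ≤
      exp (-a) * (1 + a / n) + (2 * a * (a / n) + gaussianMoment 8 / (9 * β ^ 2) / n) := by
    have hi1 : Integrable (fun x : Fin n → ℝ => exp (-a) * (1 + a - β / 384 * pairSum 4 x)) P :=
      ((integrable_const _).sub hQi).const_mul _
    have hi2 : Integrable (fun x : Fin n → ℝ => (β / 384 * pairSum 4 x) ^ 2 -
        2 * a * (β / 384 * pairSum 4 x)) P := hQ2i.sub (hQi.const_mul _)
    have hi3 : Integrable (fun x : Fin n → ℝ => (β / 384 * pairSum 4 x) ^ 2 -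
        2 * a * (β / 384 * pairSum 4 x) + a ^ 2) P := hi2.add (integrable_const _)
    have h1 : ∫ x, exp (-(β / 384 * pairSum 4 x)) ∂P ≤
        ∫ x, (exp (-a) * (1 + a - β / 384 * pairSum 4 x) + (((β / 384 * pairSum 4 x) ^ 2 -
          2 * a * (β / 384 * pairSum 4 x)) + a ^ 2)) ∂P := by
      refine integral_mono hEi (hi1.add hi3) fun x => ?_
      refine (exp_neg_le_of_nonneg ha0.le (hQ0 x)).trans_eq ?_
      ring
    rw [integral_add hi1 hi3, integral_add hi2 (integrable_const _),
      integral_sub hQ2i (hQi.const_mul _), integral_const_mul, integral_const_mul,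
      integral_sub (integrable_const _) hQi, hEQ, integral_const, integral_const] at h1
    simp only [probReal_univ, one_smul] at h1
    refine h1.trans ?_
    have : 1 + a - (a - a / n) = 1 + a / n := by ring
    rw [this]
    nlinarith [hEQ2]
  have h2 : exp (-a) ≤ 1 := exp_le_one_iff.2 (by linarith)
  rw [abs_of_nonneg (by linarith)]
  have h3 : 0 < a / n := by positivity
  have h4 : (a + 1 / (2 * β ^ 2) + gaussianMoment 8 / (9 * β ^ 2)) / n =
      a / n + 2 * a * (a / n) + gaussianMoment 8 / (9 * β ^ 2) / n := by
    rw [ha]; field_simp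
  rw [h4]
  nlinarith [mul_le_mul_of_nonneg_right h2 h3.le]

/-! ### Gaussian bounds for the kernel -/

theorem exp_neg_pairSum_eq_prod (c : ℝ) (p : ℕ → ℝ) {n : ℕ} (x : Fin n → ℝ) :
    exp (-(c * (p 0 * pairSum 2 x + p 1 * pairSum 4 x + p 2 * pairSum 6 x))) =
      ∏ j, ∏ k, exp (-(p 0 * (x j - x k) ^ 2 + p 1 * (x j - x k) ^ 4 +
        p 2 * (x j - x k) ^ 6)) ^ c := by
  simp only [← exp_mul, ← exp_sum, pairSum, Finset.mul_sum, ← Finset.sum_add_distrib,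
    ← Finset.sum_neg_distrib]
  congr 1
  exact Finset.sum_congr rfl fun j _ => Finset.sum_congr rfl fun k _ => by ring

theorem kernel_le_exp {β : ℝ} (hβ : 0 < β) {n : ℕ} {x : Fin n → ℝ}
    (hx : ∀ j k, |x j - x k| ≤ π) :
    kernel β n x ≤ exp (-(β / 16 * pairSum 2 x)) * exp (-(β / 384 * pairSum 4 x)) := by
  have h := exp_neg_pairSum_eq_prod (β / 2) (fun i => if i = 0 then 1 / 8 else if i = 1 then
    1 / 192 else 0) x
  simp only [if_true, one_ne_zero, if_false, OfNat.ofNat_ne_zero, OfNat.ofNat_ne_one, zero_mul,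
    add_zero] at h
  have e : exp (-(β / 16 * pairSum 2 x)) * exp (-(β / 384 * pairSum 4 x)) =
      exp (-(β / 2 * (1 / 8 * pairSum 2 x + 1 / 192 * pairSum 4 x))) := by
    rw [← exp_add]; ring_nf
  rw [e, h]
  refine Finset.prod_le_prod (fun _ _ => Finset.prod_nonneg fun _ _ => by positivity) fun j _ =>
    Finset.prod_le_prod (fun _ _ => by positivity) fun k _ => ?_
  refine rpow_le_rpow (abs_nonneg _) ((abs_cos_half_le_exp (hx j k)).trans_eq ?_) (by positivity)
  ring_nf

theorem exp_le_kernel {β : ℝ} (hβ : 0 < β) {n : ℕ} {x : Fin n → ℝ}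
    (hx : ∀ j k, |x j - x k| ≤ 1) :
    exp (-(β / 16 * pairSum 2 x)) *
      (exp (-(β / 384 * pairSum 4 x)) - β / 1152 * pairSum 6 x) ≤ kernel β n x := by
  have h := exp_neg_pairSum_eq_prod (β / 2) (fun i => if i = 0 then 1 / 8 else if i = 1 then
    1 / 192 else 1 / 576) x
  simp only [if_true, one_ne_zero, if_false, OfNat.ofNat_ne_zero, OfNat.ofNat_ne_one] at h
  have h4 : 0 ≤ β / 384 * pairSum 4 x :=
    mul_nonneg (by positivity) (pairSum_nonneg (by decide) x)
  have h6 : 0 ≤ β / 1152 * pairSum 6 x :=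
    mul_nonneg (by positivity) (pairSum_nonneg (by decide) x)
  have e : exp (-(β / 16 * pairSum 2 x)) * (exp (-(β / 384 * pairSum 4 x)) *
      exp (-(β / 1152 * pairSum 6 x))) =
      exp (-(β / 2 * (1 / 8 * pairSum 2 x + 1 / 192 * pairSum 4 x + 1 / 576 * pairSum 6 x))) := by
    rw [← exp_add, ← exp_add]; ring_nf
  have h1 : exp (-(β / 384 * pairSum 4 x)) - β / 1152 * pairSum 6 x ≤
      exp (-(β / 384 * pairSum 4 x)) * exp (-(β / 1152 * pairSum 6 x)) := by
    have h2 : exp (-(β / 384 * pairSum 4 x)) ≤ 1 := exp_le_one_iff.2 (by linarith)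
    have h3 := add_one_le_exp (-(β / 1152 * pairSum 6 x))
    nlinarith [mul_le_mul_of_nonneg_left h3 (exp_pos (-(β / 384 * pairSum 4 x))).le,
      mul_le_mul_of_nonneg_right h2 h6]
  refine (mul_le_mul_of_nonneg_left h1 (exp_pos _).le).trans ?_
  rw [e, h]
  refine Finset.prod_le_prod (fun _ _ => Finset.prod_nonneg fun _ _ => by positivity) fun j _ =>
    Finset.prod_le_prod (fun _ _ => by positivity) fun k _ => ?_
  refine rpow_le_rpow (exp_pos _).le (le_trans (le_of_eq ?_) (exp_le_abs_cos_half (hx j k)))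
    (by positivity)
  ring_nf

/-! ### Integration over the torus and anchoring -/

/-- Lebesgue measure on the cube `(-π, π] ^ m`, as a product measure. -/
noncomputable def circleMeasure (m : ℕ) : Measure (Fin m → ℝ) :=
  Measure.pi fun _ => volume.restrict (Set.Ioc (-π) π)

instance (m : ℕ) : IsFiniteMeasure (circleMeasure m) := by
  unfold circleMeasure; infer_instance

theorem restrict_cube (m : ℕ) : (volume : Measure (Fin m → ℝ)).restrict (cube m) =
    circleMeasure m := by
  rw [volume_pi, cube, Measure.restrict_pi_pi, circleMeasure]

theorem measurableSet_cube (m : ℕ) : MeasurableSet (cube m) :=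
  MeasurableSet.univ_pi fun _ => measurableSet_Ioc

theorem integrable_circleMeasure {m : ℕ} {F : (Fin m → ℝ) → ℝ} (hF : Continuous F) :
    Integrable F (circleMeasure m) := by
  rw [← restrict_cube]
  refine IntegrableOn.mono_set (t := Set.Icc (fun _ => -π) fun _ => π)
    hF.integrableOn_Icc ?_
  intro y hy
  exact ⟨fun j => (hy j (Set.mem_univ j)).1.le, fun j => (hy j (Set.mem_univ j)).2⟩

theorem integral_circleMeasure_succAbove {m : ℕ} {F : (Fin (m + 1) → ℝ) → ℝ} (i : Fin (m + 1)) :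
    ∫ y, F y ∂circleMeasure (m + 1) = ∫ p : ℝ × (Fin m → ℝ), F (i.insertNth p.1 p.2)
      ∂(volume.restrict (Set.Ioc (-π) π)).prod (circleMeasure m) :=
  ((measurePreserving_piFinSuccAbove (fun _ : Fin (m + 1) =>
    (volume : Measure ℝ).restrict (Set.Ioc (-π) π)) i).symm.integral_comp' F).symm

theorem integral_circleMeasure_cons {m : ℕ} {F : (Fin (m + 1) → ℝ) → ℝ} (hF : Continuous F) :
    ∫ y, F y ∂circleMeasure (m + 1) =
      ∫ a in Set.Ioc (-π) π, ∫ z, F (Fin.cons a z) ∂circleMeasure m := by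
  have hi : Integrable (fun p : ℝ × (Fin m → ℝ) => F ((0 : Fin (m + 1)).insertNth p.1 p.2))
      ((volume.restrict (Set.Ioc (-π) π)).prod (circleMeasure m)) :=
    ((measurePreserving_piFinSuccAbove (fun _ : Fin (m + 1) =>
      (volume : Measure ℝ).restrict (Set.Ioc (-π) π)) 0).symm.integrable_comp_emb
      (MeasurableEquiv.measurableEmbedding _)).2 (integrable_circleMeasure hF)
  rw [integral_circleMeasure_succAbove 0, integral_prod _ hi]
  simp only [Fin.insertNth_zero]
  rfl

/-- Translation invariance on the torus, by induction on the coordinates; each step is the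
one-variable fact that a periodic function has the same integral over every period. -/
theorem integral_circleMeasure_add {m : ℕ} {F : (Fin m → ℝ) → ℝ} (hF : Continuous F)
    (hper : ∀ y j, F (Function.update y j (y j + 2 * π)) = F y) (a : Fin m → ℝ) :
    ∫ y, F (fun j => y j + a j) ∂circleMeasure m = ∫ y, F y ∂circleMeasure m := by
  induction m with
  | zero => exact integral_congr_ae (ae_of_all _ fun y => congrArg F (Subsingleton.elim _ _))
  | succ m ih =>
    have hcons : ∀ t : ℝ, Continuous fun z : Fin m → ℝ => F (Fin.cons t z) := fun t =>
      hF.comp (continuous_finCons t m)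
    rw [integral_circleMeasure_cons hF, integral_circleMeasure_cons
      (F := fun y => F fun j => y j + a j) (hF.comp (by fun_prop))]
    have h1 : ∀ t : ℝ, ∫ z, F (fun j => (Fin.cons t z : Fin (m + 1) → ℝ) j + a j)
        ∂circleMeasure m = ∫ z, F (Fin.cons (t + a 0) z) ∂circleMeasure m := by
      intro t
      rw [← ih (hcons (t + a 0)) (fun y j => by rw [Fin.cons_update, ← hper (Fin.cons _ y) j.succ,
        Fin.cons_succ]) fun j => a j.succ]
      congr 1
      ext z
      congr 1
      ext j
      refine Fin.cases ?_ (fun j => ?_) j <;> simp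
    simp only [h1]
    have hψ : Function.Periodic (fun t => ∫ z, F (Fin.cons t z) ∂circleMeasure m) (2 * π) := by
      refine fun t => integral_congr_ae (ae_of_all _ fun z => ?_)
      simp only []
      rw [← hper (Fin.cons t z) 0, Fin.cons_zero, Fin.update_cons_zero]
    have hle : -π ≤ π := by linarith [pi_pos]
    rw [← intervalIntegral.integral_of_le hle, ← intervalIntegral.integral_of_le hle,
      intervalIntegral.integral_comp_add_right (fun t => ∫ z, F (Fin.cons t z) ∂circleMeasure m)]
    have := hψ.intervalIntegral_add_eq (-π + a 0) (-π)
    ring_nf at this ⊢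
    exact this

/-- The kernel with one more point, placed at the origin. -/
noncomputable def anchoredKernel (β : ℝ) {m : ℕ} (y : Fin m → ℝ) : ℝ :=
  kernel β (m + 1) (Fin.cons 0 y)

theorem anchoredKernel_nonneg (β : ℝ) {m : ℕ} (y : Fin m → ℝ) : 0 ≤ anchoredKernel β y :=
  kernel_nonneg β _

theorem continuous_anchoredKernel {β : ℝ} (hβ : 0 < β) (m : ℕ) :
    Continuous (anchoredKernel β : (Fin m → ℝ) → ℝ) :=
  (continuous_kernel hβ _).comp (continuous_finCons 0 m)

theorem kernel_update {β : ℝ} (hβ : 0 < β) {n : ℕ} (θ : Fin n → ℝ) (j : Fin n) :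
    kernel β n (Function.update θ j (θ j + 2 * π)) = kernel β n θ := by
  cases n with
  | zero => exact j.elim0
  | succ n =>
    rw [kernel_succAbove hβ n _ j, kernel_succAbove hβ n θ j]
    simp only [Function.update_self, Function.update_of_ne (Fin.succAbove_ne j _)]
    congr 1
    refine Finset.prod_congr rfl fun k _ => ?_
    have : (θ j + 2 * π - θ (j.succAbove k)) / 2 = (θ j - θ (j.succAbove k)) / 2 + π := by ring
    rw [this, cos_add_pi, abs_neg]

theorem kernel_add_const (β : ℝ) {n : ℕ} (θ : Fin n → ℝ) (a : ℝ) :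
    kernel β n (fun j => θ j + a) = kernel β n θ := by
  simp [kernel]

/-- Integrating the kernel against a product, relative to the position of the first point. -/
theorem integral_kernel_mul_exp {β : ℝ} (hβ : 0 < β) {f : ℝ → ℝ} (hf : Continuous f)
    (hper : Function.Periodic f (2 * π)) (m : ℕ) :
    ∫ θ, kernel β (m + 1) θ * ∏ j, exp (f (θ j)) ∂circleMeasure (m + 1) =
      ∫ a in Set.Ioc (-π) π, ∫ y, anchoredKernel β y * exp (f a + ∑ j, f (y j + a))
        ∂circleMeasure m := by
  set Φ : (Fin (m + 1) → ℝ) → ℝ := fun θ => kernel β (m + 1) θ * ∏ j, exp (f (θ j)) with hΦ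
  have hΦc : Continuous Φ := (continuous_kernel hβ _).mul (by fun_prop)
  have hΦper : ∀ y j, Φ (Function.update y j (y j + 2 * π)) = Φ y := by
    intro y j
    simp only [hΦ, kernel_update hβ]
    congr 1
    refine Finset.prod_congr rfl fun k _ => ?_
    rcases eq_or_ne k j with rfl | h
    · rw [Function.update_self, hper]
    · rw [Function.update_of_ne h]
  rw [integral_circleMeasure_cons hΦc]
  congr 1
  ext a
  rw [← integral_circleMeasure_add (F := fun z => Φ (Fin.cons a z))
    (hΦc.comp (continuous_finCons a m)) (fun y j => by
      rw [Fin.cons_update, ← hΦper (Fin.cons a y) j.succ, Fin.cons_succ]) fun _ => a]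
  congr 1
  ext y
  have : (Fin.cons a (fun j => y j + a) : Fin (m + 1) → ℝ) =
      fun j => (Fin.cons 0 y : Fin (m + 1) → ℝ) j + a := by
    ext j
    refine Fin.cases ?_ (fun j => ?_) j <;> simp
  simp only [hΦ]
  rw [this, kernel_add_const, ← exp_sum, Fin.sum_univ_succ]
  simp [anchoredKernel]

/-! ### Far configurations -/

/-- Peeling off the anchor and the far point `i` pairs up their factors at each remaining point,
where `abs_cos_half_mul_abs_cos_half_le` applies; their mutual factor is at most `1`. -/
theorem anchoredKernel_le_of_far {β : ℝ} (hβ : 0 < β) {k : ℕ} (y : Fin (k + 1) → ℝ)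
    (i : Fin (k + 1)) (h1 : π / 2 ≤ |y i|) (h2 : |y i| ≤ π) :
    anchoredKernel β y ≤ ((7 / 8 : ℝ) ^ β) ^ k * kernel β k fun l => y (i.succAbove l) := by
  rw [anchoredKernel, kernel_succAbove hβ _ _ 0]
  simp only [Fin.cons_zero, Fin.zero_succAbove, Fin.cons_succ]
  rw [Fin.prod_univ_succAbove _ i, kernel_succAbove hβ _ y i, mul_assoc, ← mul_assoc (∏ _, _),
    ← Finset.prod_mul_distrib, ← mul_assoc]
  refine mul_le_mul_of_nonneg_right ?_ (kernel_nonneg _ _)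
  have h3 : |cos ((0 - y i) / 2)| ^ β ≤ 1 :=
    rpow_le_one (abs_nonneg _) (abs_cos_le_one _) hβ.le
  have h4 : ∏ l : Fin k, |cos ((0 - y (i.succAbove l)) / 2)| ^ β *
      |cos ((y i - y (i.succAbove l)) / 2)| ^ β ≤ ((7 / 8 : ℝ) ^ β) ^ k := by
    refine (Finset.prod_le_prod (fun _ _ => by positivity) (g := fun _ => (7 / 8 : ℝ) ^ β)
      fun l _ => ?_).trans_eq (by simp)
    rw [← mul_rpow (abs_nonneg _) (abs_nonneg _), zero_sub, neg_div, cos_neg]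
    exact rpow_le_rpow (by positivity) (abs_cos_half_mul_abs_cos_half_le h1 h2 _) hβ.le
  calc _ ≤ 1 * ((7 / 8 : ℝ) ^ β) ^ k := mul_le_mul h3 h4
        (Finset.prod_nonneg fun _ _ => by positivity) zero_le_one
    _ = _ := one_mul _

/-- The total mass of the anchored kernel. -/
noncomputable def anchoredMass (β : ℝ) (m : ℕ) : ℝ :=
  ∫ y : Fin m → ℝ, anchoredKernel β y ∂circleMeasure m

/-- Configurations whose `i`-th point is at angle at least `π / 2` from the origin. -/
def farSet {m : ℕ} (i : Fin m) : Set (Fin m → ℝ) := {y | π / 2 ≤ |y i|}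

theorem measurableSet_farSet {m : ℕ} (i : Fin m) : MeasurableSet (farSet i) :=
  (isClosed_le continuous_const (continuous_apply i).abs).measurableSet

/-- The mass of the anchored kernel on the far configurations, with multiplicity. -/
noncomputable def farMass (β : ℝ) (m : ℕ) : ℝ :=
  ∑ i : Fin m, ∫ y in farSet i, anchoredKernel β y ∂circleMeasure m

theorem farMass_nonneg (β : ℝ) (m : ℕ) : 0 ≤ farMass β m :=
  Finset.sum_nonneg fun _ _ => integral_nonneg fun _ => anchoredKernel_nonneg β _

theorem ae_mem_cube (m : ℕ) : ∀ᵐ y ∂circleMeasure m, y ∈ cube m := by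
  rw [← restrict_cube]
  exact ae_restrict_mem (measurableSet_cube m)

theorem abs_le_of_mem_cube {m : ℕ} {y : Fin m → ℝ} (hy : y ∈ cube m) (i : Fin m) : |y i| ≤ π :=
  abs_le.2 ⟨(hy i (Set.mem_univ i)).1.le, (hy i (Set.mem_univ i)).2⟩

theorem volume_real_circle : (volume.restrict (Set.Ioc (-π) π)).real Set.univ = 2 * π := by
  rw [measureReal_restrict_apply_univ, volume_real_Ioc_of_le (by linarith [pi_pos])]
  ring

theorem integral_kernel_succ {β : ℝ} (hβ : 0 < β) (m : ℕ) :
    ∫ θ, kernel β (m + 1) θ ∂circleMeasure (m + 1) = 2 * π * anchoredMass β m := by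
  have h := integral_kernel_mul_exp hβ (f := fun _ => 0) continuous_const (fun _ => rfl) m
  simp only [exp_zero, Finset.prod_const_one, mul_one, Finset.sum_const_zero, add_zero,
    integral_const, volume_real_circle, smul_eq_mul] at h
  exact h

theorem setIntegral_farSet_le {β : ℝ} (hβ : 0 < β) {k : ℕ} (i : Fin (k + 1)) :
    ∫ y in farSet i, anchoredKernel β y ∂circleMeasure (k + 1) ≤
      ((7 / 8 : ℝ) ^ β) ^ k * (2 * π * ∫ z, kernel β k z ∂circleMeasure k) := by
  have hc : Continuous fun y : Fin (k + 1) → ℝ => kernel β k fun l => y (i.succAbove l) :=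
    (continuous_kernel hβ k).comp (by fun_prop)
  have h1 : ∫ y, kernel β k (fun l => y (i.succAbove l)) ∂circleMeasure (k + 1) =
      2 * π * ∫ z, kernel β k z ∂circleMeasure k := by
    rw [integral_circleMeasure_succAbove i]
    simp only [Fin.insertNth_apply_succAbove]
    rw [integral_fun_snd, volume_real_circle, smul_eq_mul]
  rw [← h1, ← integral_const_mul, ← integral_indicator (measurableSet_farSet i)]
  refine integral_mono_ae ((integrable_circleMeasure (continuous_anchoredKernel hβ _)).indicator
    (measurableSet_farSet i)) ((integrable_circleMeasure hc).const_mul _) ?_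
  filter_upwards [ae_mem_cube (k + 1)] with y hy
  by_cases hf : y ∈ farSet i
  · rw [Set.indicator_of_mem hf]
    exact anchoredKernel_le_of_far hβ y i hf (abs_le_of_mem_cube hy i)
  · rw [Set.indicator_of_notMem hf]
    exact mul_nonneg (by positivity) (kernel_nonneg _ _)

/-- The surviving `k + 1` points carry an unanchored kernel, and anchoring one of them gives
`anchoredMass β k`. The two free angles give `(2π)²`. -/
theorem farMass_add_two_le {β : ℝ} (hβ : 0 < β) (k : ℕ) :
    farMass β (k + 2) ≤
      (k + 2) * (((7 / 8 : ℝ) ^ β) ^ (k + 1) * (4 * π ^ 2 * anchoredMass β k)) := by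
  refine (Finset.sum_le_sum fun i _ => setIntegral_farSet_le hβ i).trans_eq ?_
  rw [integral_kernel_succ hβ]
  simp only [Finset.sum_const, Finset.card_univ, Fintype.card_fin, nsmul_eq_mul]
  push_cast
  ring

/-! ### Comparing the anchored kernel with the Gaussian law -/

/-- An upper bound for integrals against the anchored kernel. -/
theorem integral_anchoredKernel_mul_le {β : ℝ} (hβ : 0 < β) {m : ℕ} {h : (Fin m → ℝ) → ℝ}
    (hc : Continuous h) (h0 : ∀ y, 0 ≤ h y)
    (hi : Integrable (fun x => h (fun j => x j.succ - x 0))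
      (iidGaussian (siteVariance β (m + 1)) (m + 1))) :
    ∫ y, anchoredKernel β y * h y ∂circleMeasure m ≤
      gaussianMass β m * ∫ x, exp (-(β / 384 * pairSum 4 x)) * h (fun j => x j.succ - x 0)
        ∂iidGaussian (siteVariance β (m + 1)) (m + 1) +
      ∑ i, ∫ y in farSet i, anchoredKernel β y * h y ∂circleMeasure m := by
  have hMh := integrable_circleMeasure ((continuous_anchoredKernel hβ m).mul hc)
  set H : (Fin m → ℝ) → ℝ := fun y =>
    exp (-(β / 384 * pairSum 4 (Fin.cons 0 y : Fin (m + 1) → ℝ))) * h y with hH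
  have hHc : Continuous H := (continuous_const.mul ((continuous_pairSum 4 (m + 1)).comp
    (continuous_finCons 0 m))).neg.rexp.mul hc
  have hT : ∀ x : Fin (m + 1) → ℝ, H (fun j => x j.succ - x 0) =
      exp (-(β / 384 * pairSum 4 x)) * h (fun j => x j.succ - x 0) := fun x => by
    simp only [hH, pairSum_cons_sub]
  have hHi : Integrable (fun y => gaussianWeight β y * H y) := by
    refine integrable_mul_gaussianWeight hβ hHc.measurable (hi.mono' ?_ (ae_of_all _ fun x => ?_))
    · exact (hHc.comp (by fun_prop)).aestronglyMeasurable
    · rw [hT, norm_mul, norm_eq_abs, norm_eq_abs, abs_exp, abs_of_nonneg (h0 _)]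
      refine mul_le_of_le_one_left (h0 _) (exp_le_one_iff.2 ?_)
      have := mul_nonneg (by positivity : 0 ≤ β / 384) (pairSum_nonneg (p := 4) (by decide) x)
      linarith
  simp only [← hT]
  rw [← integral_gaussianWeight_mul hβ hHc.measurable]
  have hH0 : ∀ y, 0 ≤ gaussianWeight β y * H y := fun y =>
    mul_nonneg (exp_pos _).le (mul_nonneg (exp_pos _).le (h0 y))
  have hind : ∀ i ∈ (Finset.univ : Finset (Fin m)), Integrable (fun y => (farSet i).indicator
      (fun y => anchoredKernel β y * h y) y) (circleMeasure m) := fun i _ =>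
    hMh.indicator (measurableSet_farSet i)
  have hHr : Integrable (fun y => gaussianWeight β y * H y) (circleMeasure m) := by
    rw [← restrict_cube]; exact hHi.integrableOn
  have hle : ∫ y, gaussianWeight β y * H y ∂circleMeasure m ≤ ∫ y, gaussianWeight β y * H y := by
    rw [← restrict_cube]
    exact setIntegral_le_integral hHi (ae_of_all _ hH0)
  refine le_trans ?_ (add_le_add_left hle _)
  simp only [← integral_indicator (measurableSet_farSet _)]
  rw [← integral_finsetSum _ hind, ← integral_add hHr (integrable_finsetSum _ hind)]
  refine integral_mono hMh (hHr.add (integrable_finsetSum _ hind)) fun y => ?_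
  have hMh0 : 0 ≤ anchoredKernel β y * h y := mul_nonneg (anchoredKernel_nonneg β y) (h0 y)
  have hsum0 : ∀ i ∈ (Finset.univ : Finset (Fin m)), 0 ≤ (farSet i).indicator
      (fun y => anchoredKernel β y * h y) y := fun i _ => by
    by_cases hy : y ∈ farSet i
    · rwa [Set.indicator_of_mem hy]
    · rw [Set.indicator_of_notMem hy]
  by_cases hfar : ∃ i, y ∈ farSet i
  · obtain ⟨i, hi⟩ := hfar
    have h1 := Finset.single_le_sum hsum0 (Finset.mem_univ i)
    rw [Set.indicator_of_mem hi] at h1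
    exact h1.trans (le_add_of_nonneg_left (hH0 y))
  · push Not at hfar
    refine le_trans ?_ (le_add_of_nonneg_right (Finset.sum_nonneg hsum0))
    rw [← mul_assoc]
    refine mul_le_mul_of_nonneg_right (kernel_le_exp hβ fun j k => ?_) (h0 y)
    -- All points lie within `π/2` of the anchor, so pairwise differences are at most `π`, exactly
    -- the range of `kernel_le_exp`.
    have hb : ∀ j, |(Fin.cons 0 y : Fin (m + 1) → ℝ) j| ≤ π / 2 := fun j => by
      refine Fin.cases ?_ (fun j => ?_) j
      · simp; positivity
      · simpa using (not_le.1 (hfar j)).le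
    have := abs_sub ((Fin.cons 0 y : Fin (m + 1) → ℝ) j) ((Fin.cons 0 y : Fin (m + 1) → ℝ) k)
    linarith [hb j, hb k]

theorem integral_exp_mul_le {n : ℕ} {P : Measure (Fin n → ℝ)} {β : ℝ} (hβ : 0 < β)
    {h : (Fin n → ℝ) → ℝ} (h0 : ∀ y, 0 ≤ h y) (hi : Integrable h P) :
    ∫ x, exp (-(β / 384 * pairSum 4 x)) * h x ∂P ≤ ∫ x, h x ∂P := by
  refine integral_mono_of_nonneg (ae_of_all _ fun x => mul_nonneg (exp_pos _).le (h0 x)) hi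
    (ae_of_all _ fun x => mul_le_of_le_one_left (h0 _) (exp_le_one_iff.2 ?_))
  have := mul_nonneg (by positivity : 0 ≤ β / 384) (pairSum_nonneg (p := 4) (by decide) x)
  linarith

theorem anchoredMass_le {β : ℝ} (hβ : 0 < β) (m : ℕ) :
    anchoredMass β m ≤ gaussianMass β m * ∫ x, exp (-(β / 384 * pairSum 4 x))
      ∂iidGaussian (siteVariance β (m + 1)) (m + 1) + farMass β m := by
  have := integral_anchoredKernel_mul_le hβ (h := fun _ : Fin m → ℝ => 1) continuous_const
    (fun _ => zero_le_one) (integrable_const _)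
  simpa [anchoredMass, farMass] using this

theorem integral_exp_neg_pairSum_le_one {β : ℝ} (hβ : 0 < β) (v : ℝ≥0) (n : ℕ) :
    ∫ x, exp (-(β / 384 * pairSum 4 x)) ∂iidGaussian v n ≤ 1 := by
  have := integral_exp_mul_le (P := iidGaussian v n) hβ (h := fun _ => 1) (fun _ => zero_le_one)
    (integrable_const _)
  simpa using this

/-- Each of the `m` squared differences has Gaussian mean `8/(β(m+1))`, so their sum stays bounded
in `m`. On the far set the crude bound `|y_j| ≤ π` suffices. -/
theorem integral_anchoredKernel_mul_sum_sq_le {β : ℝ} (hβ : 0 < β) (m : ℕ) :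
    ∫ y, anchoredKernel β y * (1 + ∑ j, y j ^ 2) ∂circleMeasure m ≤
      gaussianMass β m * (1 + 8 / β) + (1 + m * π ^ 2) * farMass β m := by
  have hi : Integrable (fun x : Fin (m + 1) → ℝ => 1 + ∑ j : Fin m, (x j.succ - x 0) ^ 2)
      (iidGaussian (siteVariance β (m + 1)) (m + 1)) :=
    (integrable_const _).add (integrable_finsetSum _ fun _ _ => integrable_sub_pow 2 _ _)
  have hc : Continuous fun y : Fin m → ℝ => 1 + ∑ j, y j ^ 2 := by fun_prop
  have h1 := integral_anchoredKernel_mul_le hβ hc (fun y => by positivity) hi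
  refine h1.trans (add_le_add (mul_le_mul_of_nonneg_left ?_ (gaussianMass_pos hβ m).le) ?_)
  · refine (integral_exp_mul_le hβ (fun _ => by positivity) hi).trans ?_
    rw [integral_add (integrable_const _) (integrable_finsetSum _ fun _ _ =>
      integrable_sub_pow 2 _ _), integral_finsetSum _ fun _ _ => integrable_sub_pow 2 _ _,
      integral_const, probReal_univ, one_smul]
    simp only [integral_sub_pow 2 (Fin.succ_ne_zero _), gaussianMoment_two,
      sqrt_two_mul_siteVariance_sq hβ, Finset.sum_const, Finset.card_univ, Fintype.card_fin,
      nsmul_eq_mul]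
    push_cast
    gcongr
    rw [mul_one, ← mul_div_assoc, div_le_div_iff₀ (by positivity) hβ]
    nlinarith
  · rw [farMass, Finset.mul_sum]
    refine Finset.sum_le_sum fun i _ => ?_
    rw [← integral_const_mul]
    refine integral_mono_ae
      (integrable_circleMeasure ((continuous_anchoredKernel hβ m).mul hc)).integrableOn
      ((integrable_circleMeasure (continuous_anchoredKernel hβ m)).const_mul _).integrableOn ?_
    filter_upwards [ae_restrict_of_ae (ae_mem_cube m)] with y hy
    rw [mul_comm]
    refine mul_le_mul_of_nonneg_right ?_ (anchoredKernel_nonneg β y)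
    have : ∑ j, y j ^ 2 ≤ ∑ _j : Fin m, π ^ 2 := Finset.sum_le_sum fun j _ =>
      sq_le_sq' (abs_le.1 (abs_le_of_mem_cube hy j)).1 (abs_le.1 (abs_le_of_mem_cube hy j)).2
    simpa using this

/-- The constant `64 = 2⁶` replaces a truncation. If some `|y_i| > 1/2` then `64 * pairSum 6 ≥ 1`,
making the lower integrand nonpositive; otherwise all differences are at most `1` and
`exp_le_kernel` applies. -/
theorem le_anchoredMass {β : ℝ} (hβ : 0 < β) (m : ℕ) :
    gaussianMass β m * (∫ x, exp (-(β / 384 * pairSum 4 x))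
      ∂iidGaussian (siteVariance β (m + 1)) (m + 1) - (β / 1152 + 64) *
        ∫ x, pairSum 6 x ∂iidGaussian (siteVariance β (m + 1)) (m + 1)) ≤ anchoredMass β m := by
  set P := iidGaussian (siteVariance β (m + 1)) (m + 1)
  have hEi : Integrable (fun x : Fin (m + 1) → ℝ => exp (-(β / 384 * pairSum 4 x))) P := by
    refine (integrable_const (1 : ℝ)).mono' ?_ (ae_of_all _ fun x => ?_)
    · exact (continuous_const.mul (continuous_pairSum 4 _)).neg.rexp.aestronglyMeasurable
    · rw [norm_eq_abs, abs_exp]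
      have := mul_nonneg (by positivity : 0 ≤ β / 384) (pairSum_nonneg (p := 4) (by decide) x)
      exact exp_le_one_iff.2 (by linarith)
  have h6i : Integrable (fun x : Fin (m + 1) → ℝ => (β / 1152 + 64) * pairSum 6 x) P :=
    (integrable_pairSum 6).const_mul _
  set H : (Fin m → ℝ) → ℝ := fun y =>
    exp (-(β / 384 * pairSum 4 (Fin.cons 0 y : Fin (m + 1) → ℝ))) -
      (β / 1152 + 64) * pairSum 6 (Fin.cons 0 y : Fin (m + 1) → ℝ) with hH
  have hHc : Continuous H := (continuous_const.mul ((continuous_pairSum 4 (m + 1)).comp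
    (continuous_finCons 0 m))).neg.rexp.sub (continuous_const.mul
      ((continuous_pairSum 6 (m + 1)).comp (continuous_finCons 0 m)))
  have hT : ∀ x : Fin (m + 1) → ℝ, H (fun j => x j.succ - x 0) =
      exp (-(β / 384 * pairSum 4 x)) - (β / 1152 + 64) * pairSum 6 x := fun x => by
    simp only [hH, pairSum_cons_sub]
  have hHi : Integrable (fun y => gaussianWeight β y * H y) := by
    refine integrable_mul_gaussianWeight hβ hHc.measurable ?_
    simp only [hT]
    exact hEi.sub h6i
  rw [← integral_const_mul, ← integral_sub hEi h6i]
  simp only [← hT]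
  rw [← integral_gaussianWeight_mul hβ hHc.measurable, anchoredMass, ← restrict_cube,
    ← integral_indicator (measurableSet_cube m)]
  have hMi : Integrable ((cube m).indicator fun y : Fin m → ℝ => anchoredKernel β y) := by
    rw [integrable_indicator_iff (measurableSet_cube m), IntegrableOn, restrict_cube]
    exact integrable_circleMeasure (continuous_anchoredKernel hβ m)
  refine integral_mono hHi hMi fun y => ?_
  set x : Fin (m + 1) → ℝ := Fin.cons 0 y with hx
  have hw : 0 ≤ gaussianWeight β y := (exp_pos _).le
  have h6 : 0 ≤ pairSum 6 x := pairSum_nonneg (by decide) x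
  by_cases hy : ∀ j, |y j| ≤ 1 / 2
  · have hyc : y ∈ cube m := fun j _ =>
      ⟨by linarith [(abs_le.1 (hy j)).1, pi_gt_three], by linarith [(abs_le.1 (hy j)).2, pi_gt_three]⟩
    rw [Set.indicator_of_mem hyc]
    have hb : ∀ j, |x j| ≤ 1 / 2 := fun j => by
      refine Fin.cases ?_ (fun j => ?_) j
      · simp [hx]
      · simpa [hx] using hy j
    refine le_trans (mul_le_mul_of_nonneg_left ?_ hw) (exp_le_kernel hβ (x := x) fun j k => ?_)
    · simp only [hH]
      linarith
    · have := abs_sub (x j) (x k)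
      linarith [hb j, hb k]
  · push Not at hy
    obtain ⟨i, hi⟩ := hy
    refine le_trans (mul_nonpos_of_nonneg_of_nonpos hw ?_)
      (Set.indicator_nonneg (fun y _ => anchoredKernel_nonneg β y) y)
    have h1 : y i ^ 6 ≤ pairSum 6 x := by
      have h2 : (x i.succ - x 0) ^ 6 ≤ ∑ k, (x i.succ - x k) ^ 6 :=
        Finset.single_le_sum (f := fun k => (x i.succ - x k) ^ 6)
          (fun k _ => Even.pow_nonneg (by decide) _) (Finset.mem_univ 0)
      have h3 : ∑ k, (x i.succ - x k) ^ 6 ≤ pairSum 6 x :=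
        Finset.single_le_sum (f := fun j => ∑ k, (x j - x k) ^ 6)
          (fun j _ => Finset.sum_nonneg fun k _ => Even.pow_nonneg (by decide) _)
          (Finset.mem_univ i.succ)
      simpa [hx] using h2.trans h3
    have h2 : (1 / 2 : ℝ) ^ 6 ≤ y i ^ 6 := by
      rw [← Even.pow_abs (by decide : Even 6) (y i)]
      exact pow_le_pow_left₀ (by norm_num) hi.le 6
    have h4 : exp (-(β / 384 * pairSum 4 x)) ≤ 1 := exp_le_one_iff.2 (by
      have := mul_nonneg (by positivity : 0 ≤ β / 384) (pairSum_nonneg (p := 4) (by decide) x)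
      linarith)
    have h5 : 0 ≤ β / 1152 * pairSum 6 x := by positivity
    simp only [hH]
    rw [add_mul]
    norm_num at h2
    linarith

/-! ### The two-step recursion for the mass -/

theorem exists_bound_of_two_step {a e : ℕ → ℝ} (ha : ∀ k, 0 ≤ a k)
    (hrec : ∀ k, a (k + 2) ≤ 1 + e k * a k) (he : Tendsto e atTop (𝓝 0)) :
    ∃ A, ∀ k, a k ≤ A := by
  obtain ⟨N, hN⟩ := eventually_atTop.1 (he.eventually_le_const (by norm_num : (0 : ℝ) < 1 / 2))
  set S := ∑ i ∈ Finset.range (N + 2), a i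
  -- Once the coefficient is at most `1/2`, a bound `M ≥ 2` reproduces itself, as `1 + M/2 ≤ M`.
  refine ⟨max 2 S, fun k => ?_⟩
  induction k using Nat.strong_induction_on with
  | _ k ih =>
    rcases lt_or_ge k (N + 2) with h | h
    · exact (Finset.single_le_sum (fun i _ => ha i) (Finset.mem_range.2 h)).trans
        (le_max_right _ _)
    · obtain ⟨l, rfl⟩ : ∃ l, k = l + 2 := ⟨k - 2, by omega⟩
      have h1 := hN l (by omega)
      have h2 := ih l (by omega)
      have h3 : (2 : ℝ) ≤ max 2 S := le_max_left _ _
      nlinarith [hrec l, mul_le_mul_of_nonneg_right h1 (ha l)]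

/-- Removing two points costs only a linear factor, because `(1 + 2/(k+1))^{k/2} ≤ e`. The geometric
decay in `farMass_add_two_le` absorbs it. -/
theorem gaussianMass_le_add_two {β : ℝ} (hβ : 0 < β) (k : ℕ) :
    gaussianMass β k ≤ β / (8 * π) * exp 1 * (k + 3) * gaussianMass β (k + 2) := by
  unfold gaussianMass
  push_cast
  have e3 : (k : ℝ) + 2 + 1 = k + 3 := by ring
  rw [e3]
  set t := √(8 * π / (β * (k + 3))) with ht
  have ht0 : 0 < t := sqrt_pos.2 (by positivity)
  have ht2 : t ^ 2 = 8 * π / (β * (k + 3)) := sq_sqrt (by positivity)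
  have hs : √(8 * π / (β * (k + 1))) ≤ t * exp (1 / (k + 1)) := by
    have h1 : 8 * π / (β * (k + 1)) = 8 * π / (β * (k + 3)) * (2 / (k + 1) + 1) := by
      field_simp
      ring
    rw [h1, sqrt_mul (by positivity)]
    refine mul_le_mul_of_nonneg_left ?_ ht0.le
    rw [sqrt_le_left (exp_pos _).le, ← exp_nat_mul]
    refine (add_one_le_exp _).trans_eq ?_
    push_cast
    ring_nf
  have hk : exp (1 / ((k : ℝ) + 1)) ^ k ≤ exp 1 := by
    rw [← exp_nat_mul, exp_le_exp, mul_one_div, div_le_one (by positivity)]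
    linarith
  have hsq : √((k : ℝ) + 1) ≤ √((k : ℝ) + 3) := sqrt_le_sqrt (by linarith)
  calc √(8 * π / (β * (k + 1))) ^ k * √(k + 1)
      ≤ (t * exp (1 / (k + 1))) ^ k * √(k + 3) := by gcongr
    _ = t ^ k * exp (1 / (k + 1)) ^ k * √(k + 3) := by rw [mul_pow]
    _ ≤ t ^ k * exp 1 * √(k + 3) := by gcongr
    _ = β / (8 * π) * exp 1 * (k + 3) * (t ^ (k + 2) * √(k + 3)) := by
      rw [pow_add, ht2]
      field_simp

theorem tendsto_pow_mul_geometric {ρ : ℝ} (h0 : 0 < ρ) (h1 : ρ < 1) :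
    Tendsto (fun k : ℕ => ((k : ℝ) + 3) ^ 4 * ρ ^ k) atTop (𝓝 0) := by
  have h := (tendsto_add_atTop_iff_nat 3).2 (tendsto_pow_const_mul_const_pow_of_abs_lt_one 4
    (abs_lt.2 ⟨by linarith, h1⟩ : |ρ| < 1))
  have h2 := h.mul_const ((ρ ^ 3)⁻¹)
  rw [zero_mul] at h2
  refine h2.congr fun k => ?_
  push_cast
  rw [pow_add]
  field_simp

theorem farMass_add_two_le_mul {β : ℝ} (hβ : 0 < β) :
    ∃ E : ℝ, 0 ≤ E ∧ ∀ k : ℕ, farMass β (k + 2) ≤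
      E * ((k + 3) ^ 2 * ((7 / 8 : ℝ) ^ β) ^ k) * (anchoredMass β k / gaussianMass β k) *
        gaussianMass β (k + 2) := by
  refine ⟨(7 / 8 : ℝ) ^ β * (4 * π ^ 2) * (β / (8 * π) * exp 1), by positivity, fun k => ?_⟩
  refine (farMass_add_two_le hβ k).trans ?_
  have hg := gaussianMass_pos hβ k
  have hW : 0 ≤ anchoredMass β k := integral_nonneg fun y => anchoredKernel_nonneg β y
  have hr : anchoredMass β k = anchoredMass β k / gaussianMass β k * gaussianMass β k := by
    field_simp
  set r := anchoredMass β k / gaussianMass β k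
  have hr0 : 0 ≤ r := by positivity
  rw [hr]
  have h2 : (0 : ℝ) ≤ gaussianMass β (k + 2) := (gaussianMass_pos hβ _).le
  calc (k + 2) * (((7 / 8 : ℝ) ^ β) ^ (k + 1) * (4 * π ^ 2 * (r * gaussianMass β k)))
      ≤ (k + 3) * (((7 / 8 : ℝ) ^ β) ^ (k + 1) * (4 * π ^ 2 * (r * (β / (8 * π) * exp 1 *
        (k + 3) * gaussianMass β (k + 2))))) := by
        gcongr
        · norm_num
        · exact gaussianMass_le_add_two hβ k
    _ = _ := by
        rw [pow_succ]
        ring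

theorem exists_anchoredMass_le {β : ℝ} (hβ : 0 < β) :
    ∃ A : ℝ, ∀ m, anchoredMass β m / gaussianMass β m ≤ A := by
  obtain ⟨E, hE, hfar⟩ := farMass_add_two_le_mul hβ
  have hρ0 : (0 : ℝ) < (7 / 8) ^ β := by positivity
  have hρ1 : (7 / 8 : ℝ) ^ β < 1 := rpow_lt_one (by norm_num) (by norm_num) hβ
  refine exists_bound_of_two_step (e := fun k => E * ((k + 3) ^ 2 * ((7 / 8 : ℝ) ^ β) ^ k))
    (fun k => div_nonneg (integral_nonneg fun y => anchoredKernel_nonneg β y)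
      (gaussianMass_pos hβ k).le) (fun k => ?_) ?_
  · have hg := gaussianMass_pos hβ (k + 2)
    rw [div_le_iff₀ hg, add_mul, one_mul]
    refine (anchoredMass_le hβ (k + 2)).trans (add_le_add ?_ (hfar k))
    exact mul_le_of_le_one_right hg.le (integral_exp_neg_pairSum_le_one hβ _ _)
  · have h := (tendsto_pow_mul_geometric hρ0 hρ1).const_mul E
    rw [mul_zero] at h
    refine squeeze_zero (fun k => by positivity) (fun k => ?_) h
    have : (1 : ℝ) ≤ k + 3 := by linarith [k.cast_nonneg (α := ℝ)]
    gcongr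
    norm_num

/-- The weight `1 + mπ²` bounds `1 + ∑ y_j²` on the cube, so one estimate serves both the mass and
its second-moment version. -/
theorem exists_farMass_le {β : ℝ} (hβ : 0 < β) :
    ∃ C : ℝ, 0 ≤ C ∧ ∀ m : ℕ, 2 ≤ m →
      (1 + m * π ^ 2) * farMass β m ≤ C / (m + 1) * gaussianMass β m := by
  obtain ⟨E, hE, hfar⟩ := farMass_add_two_le_mul hβ
  obtain ⟨A, hA⟩ := exists_anchoredMass_le hβ
  have hρ0 : (0 : ℝ) < (7 / 8) ^ β := by positivity
  have hρ1 : (7 / 8 : ℝ) ^ β < 1 := rpow_lt_one (by norm_num) (by norm_num) hβ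
  obtain ⟨B, hB⟩ := (tendsto_pow_mul_geometric hρ0 hρ1).bddAbove_range
  have hA0 : 0 ≤ A := (div_nonneg (integral_nonneg fun y => anchoredKernel_nonneg β y)
    (gaussianMass_pos hβ 0).le).trans (hA 0)
  have hB0 : 0 ≤ B := le_trans (by positivity) (hB ⟨0, rfl⟩)
  refine ⟨π ^ 2 * E * A * B, by positivity, fun m hm => ?_⟩
  obtain ⟨k, rfl⟩ : ∃ k, m = k + 2 := ⟨m - 2, by omega⟩
  have hg := gaussianMass_pos hβ (k + 2)
  have hBk : ((k : ℝ) + 3) ^ 4 * ((7 / 8 : ℝ) ^ β) ^ k ≤ B := hB ⟨k, rfl⟩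
  have hπ : 1 + ((k + 2 : ℕ) : ℝ) * π ^ 2 ≤ π ^ 2 * (k + 3) := by
    push_cast
    nlinarith [pi_gt_three]
  calc (1 + ((k + 2 : ℕ) : ℝ) * π ^ 2) * farMass β (k + 2)
      ≤ (π ^ 2 * (k + 3)) * (E * ((k + 3) ^ 2 * ((7 / 8 : ℝ) ^ β) ^ k) * A *
        gaussianMass β (k + 2)) := by
        refine mul_le_mul hπ ((hfar k).trans ?_) (farMass_nonneg β _) (by positivity)
        gcongr
        exact hA k
    _ = π ^ 2 * E * A * ((k + 3) ^ 4 * ((7 / 8 : ℝ) ^ β) ^ k) / (k + 3) *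
        gaussianMass β (k + 2) := by
        field_simp
    _ ≤ π ^ 2 * E * A * B / (k + 3) * gaussianMass β (k + 2) := by gcongr
    _ = _ := by push_cast; ring_nf

/-! ### Asymptotics of the mass and the partition function -/

/-- The anchored mass relative to the Gaussian mass, with a rate. -/
theorem anchoredMass_asymptotics {β : ℝ} (hβ : 0 < β) :
    ∃ C : ℝ, ∀ m : ℕ, 2 ≤ m →
      |anchoredMass β m - gaussianMass β m * exp (-(1 / (2 * β)))| ≤
        C / (m + 1) * gaussianMass β m := by
  obtain ⟨C1, h1⟩ := integral_exp_neg_pairSum_four hβ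
  obtain ⟨C2, hC2, h2⟩ := exists_farMass_le hβ
  -- There are at most `n²` pairs, each with sixth moment `(8/(βn))³` times the standard one, which
  -- leaves order `1/n`.
  set D := (β / 1152 + 64) * (512 / β ^ 3 * gaussianMoment 6) with hD
  have hD0 : 0 ≤ D := mul_nonneg (by positivity) (mul_nonneg (by positivity)
    (gaussianMoment_nonneg (by decide)))
  refine ⟨C1 + C2 + D, fun m hm => ?_⟩
  have hg := gaussianMass_pos hβ m
  have hm0 : (0 : ℝ) < m + 1 := by positivity
  have h3 := abs_le.1 (h1 (m + 1) (by omega))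
  push_cast at h3
  set I := ∫ x, exp (-(β / 384 * pairSum 4 x)) ∂iidGaussian (siteVariance β (m + 1)) (m + 1)
  have hup := anchoredMass_le hβ m
  have hlo := le_anchoredMass hβ m
  have hfar : farMass β m ≤ C2 / (m + 1) * gaussianMass β m := by
    refine le_trans ?_ (h2 m hm)
    exact le_mul_of_one_le_left (farMass_nonneg β m) (le_add_of_nonneg_right (by positivity))
  have h6 : (β / 1152 + 64) * ∫ x, pairSum 6 x ∂iidGaussian (siteVariance β (m + 1)) (m + 1) ≤
      D / (m + 1) := by
    have hs : √(2 * siteVariance β (m + 1) : ℝ) ^ 6 = (8 / (β * (m + 1))) ^ 3 := by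
      have h := sqrt_two_mul_siteVariance_sq hβ (m + 1)
      push_cast at h
      rw [← h]
      ring
    have h := integral_pairSum_le (v := siteVariance β (m + 1)) (n := m + 1) (p := 6)
      (by decide) (by norm_num)
    rw [hs] at h
    refine (mul_le_mul_of_nonneg_left h (by positivity)).trans_eq ?_
    rw [hD]
    push_cast
    field_simp
    ring
  have e : (C1 + C2 + D) / (m + 1) * gaussianMass β m = gaussianMass β m * (C1 / (m + 1)) +
      C2 / (m + 1) * gaussianMass β m + gaussianMass β m * (D / (m + 1)) := by ring
  have hC2' : 0 ≤ C2 / (m + 1) * gaussianMass β m := by positivity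
  have hD' : 0 ≤ gaussianMass β m * (D / (m + 1)) := by positivity
  rw [e, abs_le]
  constructor
  · nlinarith [mul_le_mul_of_nonneg_left h6 hg.le, mul_le_mul_of_nonneg_left h3.1 hg.le]
  · nlinarith [mul_le_mul_of_nonneg_left h3.2 hg.le]

theorem exists_integral_anchoredKernel_mul_sum_sq_le {β : ℝ} (hβ : 0 < β) :
    ∃ C : ℝ, 0 ≤ C ∧ ∀ m : ℕ, 2 ≤ m →
      ∫ y : Fin m → ℝ, anchoredKernel β y * (1 + ∑ j, y j ^ 2) ∂circleMeasure m ≤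
        C * gaussianMass β m := by
  obtain ⟨C, hC0, hC⟩ := exists_farMass_le hβ
  refine ⟨1 + 8 / β + C, by positivity, fun m hm => ?_⟩
  have hg := gaussianMass_pos hβ m
  have h1 : C / (m + 1) ≤ C := div_le_self hC0 (by linarith [m.cast_nonneg (α := ℝ)])
  have := integral_anchoredKernel_mul_sum_sq_le hβ m
  nlinarith [hC m hm, mul_le_mul_of_nonneg_right h1 hg.le]

theorem leadingFactor_succ {β : ℝ} (hβ : 0 < β) (m : ℕ) :
    leadingFactor β (m + 1) =
      2 ^ (β * (((m + 1 : ℕ) : ℝ) * (((m + 1 : ℕ) : ℝ) - 1) / 2)) *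
        (gaussianMass β m * exp (-(1 / (2 * β)))) := by
  unfold leadingFactor gaussianMass
  have e : (((m + 1 : ℕ) : ℝ) - 1) / 2 = m / 2 := by push_cast; ring
  rw [e, rpow_div_two_eq_sqrt _ (by positivity), rpow_natCast]
  push_cast
  ring

theorem multiIntegral_eq {β : ℝ} (hβ : 0 < β) (n : ℕ) (f : ℝ → ℝ) :
    multiIntegral β n f = 2 ^ (β * ((n : ℝ) * ((n : ℝ) - 1) / 2)) *
      ∫ θ, kernel β n θ * ∏ j, exp (f (θ j)) ∂circleMeasure n := by
  unfold multiIntegral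
  rw [restrict_cube, ← integral_const_mul]
  simp only [interaction_eq hβ, mul_assoc]

theorem partitionFunction_eq_multiIntegral (β : ℝ) (n : ℕ) :
    partitionFunction β n = multiIntegral β n fun _ => 0 := by
  simp [partitionFunction, multiIntegral]

theorem partitionFunction_succ {β : ℝ} (hβ : 0 < β) (m : ℕ) :
    partitionFunction β (m + 1) =
      2 ^ (β * (((m + 1 : ℕ) : ℝ) * (((m + 1 : ℕ) : ℝ) - 1) / 2)) *
        (2 * π * anchoredMass β m) := by
  rw [partitionFunction_eq_multiIntegral, multiIntegral_eq hβ, ← integral_kernel_succ hβ]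
  simp

theorem inv_natCast_le_rpow_neg {n : ℕ} (hn : 1 ≤ n) {ζ : ℝ} (hζ : ζ ≤ 1) :
    1 / (n : ℝ) ≤ (n : ℝ) ^ (-ζ) := by
  rw [one_div, ← rpow_neg_one]
  exact rpow_le_rpow_of_exponent_le (by exact_mod_cast hn) (by linarith)

theorem partitionFunction_asymptotics {β : ℝ} (hβ : 0 < β) {ζ : ℝ} (hζ : ζ ≤ 1) :
    ∃ C : ℝ, ∃ N : ℕ, ∀ n : ℕ, N ≤ n → ∃ r : ℝ, |r| ≤ C * (n : ℝ) ^ (-ζ) ∧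
      partitionFunction β n = leadingFactor β n * (2 * π) * (1 + r) := by
  obtain ⟨C, hC⟩ := anchoredMass_asymptotics hβ
  -- The exponential turns an error relative to the Gaussian mass into one relative to the leading
  -- term; `3` ensures `m ≥ 2`.
  refine ⟨|C| * exp (1 / (2 * β)), 3, fun n hn => ?_⟩
  obtain ⟨m, rfl⟩ : ∃ m, n = m + 1 := ⟨n - 1, by omega⟩
  have hg := gaussianMass_pos hβ m
  have h1 := hC m (by omega)
  have h2 := inv_natCast_le_rpow_neg (n := m + 1) (by omega) hζ
  have he : exp (1 / (2 * β)) * exp (-(1 / (2 * β))) = 1 := by rw [← exp_add]; simp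
  have he0 := exp_pos (1 / (2 * β))
  set E := exp (-(1 / (2 * β)))
  have hE0 : 0 < E := exp_pos _
  refine ⟨(anchoredMass β m - gaussianMass β m * E) / (gaussianMass β m * E), ?_, ?_⟩
  · rw [abs_div, abs_of_pos (mul_pos hg hE0), div_le_iff₀ (mul_pos hg hE0)]
    refine h1.trans ?_
    have h3 : C / (m + 1) ≤ |C| * ((m + 1 : ℕ) : ℝ) ^ (-ζ) := by
      push_cast at h2 ⊢
      rw [div_eq_mul_one_div]
      exact mul_le_mul (le_abs_self C) h2 (by positivity) (abs_nonneg C)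
    calc C / (m + 1) * gaussianMass β m ≤ |C| * ((m + 1 : ℕ) : ℝ) ^ (-ζ) * gaussianMass β m := by
          gcongr
      _ = |C| * ((m + 1 : ℕ) : ℝ) ^ (-ζ) * gaussianMass β m * (exp (1 / (2 * β)) * E) := by
          rw [he, mul_one]
      _ = _ := by ring
  · rw [partitionFunction_succ hβ, leadingFactor_succ hβ, show exp (-(1 / (2 * β))) = E from rfl]
    field_simp
    ring

/-! ### The Hölder test function -/

theorem integral_circleMeasure_mul {m : ℕ} {F : ℝ → ℝ} {G : (Fin m → ℝ) → ℝ} (hF : Continuous F)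
    (hG : Continuous G) :
    ∫ θ, F (θ 0) * G (fun j => θ j.succ) ∂circleMeasure (m + 1) =
      (∫ a in Set.Ioc (-π) π, F a) * ∫ y, G y ∂circleMeasure m := by
  rw [integral_circleMeasure_cons (F := fun θ => F (θ 0) * G (fun j => θ j.succ))
    ((hF.comp (continuous_apply 0)).mul (hG.comp (by fun_prop)))]
  simp only [Fin.cons_zero, Fin.cons_succ, integral_const_mul]
  rw [integral_mul_const]

theorem abs_exp_sub_one_le_mul_exp (x : ℝ) : |exp x - 1| ≤ |x| * exp |x| := by
  rcases le_total 0 x with h | h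
  · rw [abs_of_nonneg h, abs_of_nonneg (sub_nonneg.2 (one_le_exp h))]
    have h1 := add_one_le_exp (-x)
    have h2 : exp (-x) * exp x = 1 := by rw [← exp_add]; simp
    nlinarith [mul_le_mul_of_nonneg_right h1 (exp_pos x).le]
  · rw [abs_of_nonpos h, abs_of_nonpos (sub_nonpos.2 (exp_le_one_iff.2 h))]
    have h1 := add_one_le_exp x
    have h2 : 1 ≤ exp (-x) := one_le_exp (by linarith)
    nlinarith

/-- Rescaling by `√n` reduces this to `s^q ≤ 1 + s²`. This is where the rate `n^{-q/2}` originates: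
only second moments of the points are then needed. -/
theorem abs_rpow_le_of_le_two {q n : ℝ} (hq0 : 0 ≤ q) (hq2 : q ≤ 2) (hn : 0 < n) (u : ℝ) :
    |u| ^ q ≤ n ^ (-(q / 2)) * (1 + n * u ^ 2) := by
  have hs : 0 < √n := sqrt_pos.2 hn
  have h1 : (√n * |u|) ^ q ≤ 1 + n * u ^ 2 := by
    have e : n * u ^ 2 = (√n * |u|) ^ 2 := by rw [mul_pow, sq_sqrt hn.le, sq_abs]
    rw [e]
    have h0 : 0 ≤ √n * |u| := by positivity
    rcases le_total (√n * |u|) 1 with h | h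
    · exact (rpow_le_one h0 h hq0).trans (by linarith [sq_nonneg (√n * |u|)])
    · have := rpow_le_rpow_of_exponent_le h hq2
      rw [rpow_two] at this
      linarith
  have h2 : |u| ^ q = n ^ (-(q / 2)) * (√n * |u|) ^ q := by
    rw [mul_rpow hs.le (abs_nonneg u), sqrt_eq_rpow, ← rpow_mul hn.le, ← mul_assoc,
      ← rpow_add hn, show -(q / 2) + 1 / 2 * q = 0 by ring, rpow_zero, one_mul]
  rw [h2]
  gcongr

/-- The average of a Hölder function over the points is close to its value at the first one. -/
theorem abs_sum_holder_sub_le {q c : ℝ≥0} {g : ℝ → ℝ}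
    (hg : HolderWith c q g) {t T : ℝ} (ht : |t| ≤ T) {m : ℕ} (a : ℝ) (y : Fin m → ℝ) :
    |t / ((m + 1 : ℕ) : ℝ) * g a + ∑ j, t / ((m + 1 : ℕ) : ℝ) * g (y j + a) - t * g a| ≤
      T / (m + 1) * ∑ j, c * |y j| ^ (q : ℝ) := by
  have e : t / ((m + 1 : ℕ) : ℝ) * g a + ∑ j, t / ((m + 1 : ℕ) : ℝ) * g (y j + a) - t * g a =
      t / (m + 1) * ∑ j, (g (y j + a) - g a) := by
    simp only [Finset.sum_sub_distrib, ← Finset.mul_sum, Finset.sum_const, Finset.card_univ,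
      Fintype.card_fin, nsmul_eq_mul]
    push_cast
    field_simp
    ring
  rw [e, abs_mul, abs_div, abs_of_pos (by positivity : (0 : ℝ) < m + 1)]
  refine mul_le_mul (by gcongr) ((Finset.abs_sum_le_sum_abs _ _).trans
    (Finset.sum_le_sum fun j _ => ?_)) (abs_nonneg _) (div_nonneg ((abs_nonneg t).trans ht)
      (by positivity))
  have := hg.dist_le (y j + a) a
  simpa [Real.dist_eq] using this

theorem multiIntegral_asymptotics {β : ℝ} (hβ : 0 < β) {q : ℝ≥0} (hq0 : 0 < q) (hq1 : q ≤ 1)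
    {g : ℝ → ℝ} (hper : Function.Periodic g (2 * π)) (hg : MemHolder q g) {ζ : ℝ}
    (hζ : ζ ≤ (q : ℝ) / 2) {T : ℝ} (hT : 0 ≤ T) :
    ∃ C : ℝ, ∃ N : ℕ, ∀ n : ℕ, N ≤ n → ∀ t : ℝ, |t| ≤ T →
      ∃ r : ℝ, |r| ≤ C * (n : ℝ) ^ (-ζ) ∧
        multiIntegral β n (fun x => t / (n : ℝ) * g x) =
          leadingFactor β n * (1 + r) * ∫ θ in (-π)..π, exp (t * g θ) := by
  obtain ⟨c, hc⟩ := hg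
  have hgc : Continuous g := hc.continuous hq0
  have hq1' : (q : ℝ) ≤ 1 := by exact_mod_cast hq1
  obtain ⟨C₁, hC₁⟩ := anchoredMass_asymptotics hβ
  obtain ⟨C₂, hC₂0, hC₂⟩ := exists_integral_anchoredKernel_mul_sum_sq_le hβ
  -- A bound on the deviation of the exponent uniform in `n`, so that `|e^D - 1| ≤ |D| e^B` is
  -- linear in `D`.
  set B := T * (c * π ^ (q : ℝ)) with hB
  set K := T * c * exp B * C₂ with hK
  have hK0 : 0 ≤ K := by positivity
  refine ⟨(K + |C₁|) * exp (1 / (2 * β)), 3, fun n hn t ht => ?_⟩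
  obtain ⟨m, rfl⟩ : ∃ m, n = m + 1 := ⟨n - 1, by omega⟩
  have hm0 : (0 : ℝ) < m + 1 := by positivity
  have hmass := gaussianMass_pos hβ m
  set G := ∫ a in Set.Ioc (-π) π, exp (t * g a) with hG
  have hGi : ∫ θ in (-π)..π, exp (t * g θ) = G :=
    intervalIntegral.integral_of_le (by linarith [pi_pos])
  have hG0 : 0 < G := by
    rw [← hGi]
    exact intervalIntegral.intervalIntegral_pos_of_pos
      (Continuous.intervalIntegrable (by fun_prop) _ _) (fun _ => exp_pos _) (by linarith [pi_pos])
  set f : ℝ → ℝ := fun x => t / ((m + 1 : ℕ) : ℝ) * g x with hf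
  have hfc : Continuous f := by fun_prop
  have hfper : Function.Periodic f (2 * π) := fun x => by simp only [hf, hper x]
  have hMc := continuous_anchoredKernel hβ m
  have htail : Continuous fun θ : Fin (m + 1) → ℝ => anchoredKernel β (fun j => θ j.succ) :=
    hMc.comp (by fun_prop)
  -- Coordinate `0` is the absolute angle of the anchor; the others are relative to it.
  set Ψ : (Fin (m + 1) → ℝ) → ℝ := fun θ => anchoredKernel β (fun j => θ j.succ) *
    exp (f (θ 0) + ∑ j : Fin m, f (θ j.succ + θ 0)) with hΨ
  have hΨc : Continuous Ψ := htail.mul (by fun_prop)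
  set J := ∫ θ, Ψ θ ∂circleMeasure (m + 1) with hJ
  have hIJ : ∫ θ, kernel β (m + 1) θ * ∏ j, exp (f (θ j)) ∂circleMeasure (m + 1) = J := by
    rw [integral_kernel_mul_exp hβ hfc hfper, hJ, integral_circleMeasure_cons hΨc]
    simp only [hΨ, Fin.cons_zero, Fin.cons_succ]
  have hGW : ∫ θ, exp (t * g (θ 0)) * anchoredKernel β (fun j => θ j.succ)
      ∂circleMeasure (m + 1) = G * anchoredMass β m :=
    integral_circleMeasure_mul (F := fun a => exp (t * g a)) (by fun_prop) hMc
  have hBi : ∫ θ, exp (t * g (θ 0)) * (anchoredKernel β (fun j => θ j.succ) *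
      (1 + ∑ j : Fin m, θ j.succ ^ 2)) ∂circleMeasure (m + 1) =
      G * ∫ y, anchoredKernel β y * (1 + ∑ j, y j ^ 2) ∂circleMeasure m :=
    integral_circleMeasure_mul (F := fun a => exp (t * g a))
      (G := fun y => anchoredKernel β y * (1 + ∑ j, y j ^ 2)) (by fun_prop)
      (hMc.mul (by fun_prop))
  set ν : ℝ := ((m + 1 : ℕ) : ℝ) ^ (-((q : ℝ) / 2)) with hν
  have hν0 : 0 ≤ ν := by positivity
  -- Replacing the averaged `g` by its value at the anchor decouples the anchor from the relative
  -- angles; the error is `ν` times the bounded second-moment integral.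
  have hdiff : |J - G * anchoredMass β m| ≤ G * gaussianMass β m * (K * ν) := by
    have hic : Continuous fun θ : Fin (m + 1) → ℝ =>
        exp (t * g (θ 0)) * anchoredKernel β (fun j => θ j.succ) :=
      Continuous.mul (by fun_prop) htail
    have hbc : Continuous fun θ : Fin (m + 1) → ℝ => exp (t * g (θ 0)) *
        (anchoredKernel β (fun j => θ j.succ) * (1 + ∑ j : Fin m, θ j.succ ^ 2)) :=
      Continuous.mul (by fun_prop) (htail.mul (by fun_prop))
    rw [← hGW, hJ, ← integral_sub (integrable_circleMeasure hΨc) (integrable_circleMeasure hic)]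
    have h1 := norm_integral_le_of_norm_le (f := fun θ => Ψ θ -
        exp (t * g (θ 0)) * anchoredKernel β (fun j => θ j.succ))
      ((integrable_circleMeasure hbc).const_mul (T * c * exp B * ν)) (by
        filter_upwards [ae_mem_cube (m + 1)] with θ hθ
        have h2 := abs_sum_holder_sub_le hc ht (θ 0) (fun j : Fin m => θ j.succ)
        set D := f (θ 0) + ∑ j : Fin m, f (θ j.succ + θ 0) - t * g (θ 0) with hD
        have hDB : |D| ≤ B := by
          refine h2.trans ?_
          have : ∑ j : Fin m, (c : ℝ) * |θ j.succ| ^ (q : ℝ) ≤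
              ∑ _j : Fin m, (c : ℝ) * π ^ (q : ℝ) := by
            gcongr with j
            exact abs_le_of_mem_cube hθ _
          rw [Finset.sum_const, Finset.card_univ, Fintype.card_fin, nsmul_eq_mul] at this
          rw [hB, div_mul_eq_mul_div, mul_div_assoc]
          refine mul_le_mul_of_nonneg_left ?_ hT
          rw [div_le_iff₀ hm0]
          have hp : 0 ≤ (c : ℝ) * π ^ (q : ℝ) := by positivity
          nlinarith
        have hDν : |D| ≤ T * c * ν * (1 + ∑ j : Fin m, θ j.succ ^ 2) := by
          refine h2.trans ?_
          have h3 : ∑ j : Fin m, (c : ℝ) * |θ j.succ| ^ (q : ℝ) ≤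
              ∑ j : Fin m, (c : ℝ) * (ν * (1 + (m + 1) * θ j.succ ^ 2)) := by
            refine Finset.sum_le_sum fun j _ => mul_le_mul_of_nonneg_left ?_ c.coe_nonneg
            have := abs_rpow_le_of_le_two (q := q) (n := ((m + 1 : ℕ) : ℝ)) q.coe_nonneg
              (by linarith) (by positivity) (θ j.succ)
            rw [← hν] at this
            push_cast at this ⊢
            exact this
          have h4 : ∑ j : Fin m, (c : ℝ) * (ν * (1 + (m + 1) * θ j.succ ^ 2)) =
              c * ν * (m + (m + 1) * ∑ j : Fin m, θ j.succ ^ 2) := by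
            simp only [← Finset.mul_sum, Finset.sum_add_distrib, Finset.sum_const,
              Finset.card_univ, Fintype.card_fin, nsmul_eq_mul, mul_one]
            ring
          rw [h4] at h3
          have h5 : 0 ≤ (c : ℝ) * ν := by positivity
          calc T / (m + 1) * ∑ j : Fin m, (c : ℝ) * |θ j.succ| ^ (q : ℝ)
              ≤ T / (m + 1) * (c * ν * ((m + 1) * (1 + ∑ j : Fin m, θ j.succ ^ 2))) := by
                refine mul_le_mul_of_nonneg_left (h3.trans ?_) (by positivity)
                refine mul_le_mul_of_nonneg_left ?_ h5
                linarith
            _ = _ := by field_simp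
        have hM := anchoredKernel_nonneg β (fun j : Fin m => θ j.succ)
        set M := anchoredKernel β (fun j : Fin m => θ j.succ)
        have e1 : Ψ θ - exp (t * g (θ 0)) * M = exp (t * g (θ 0)) * (M * (exp D - 1)) := by
          have : f (θ 0) + ∑ j : Fin m, f (θ j.succ + θ 0) = t * g (θ 0) + D := by rw [hD]; ring
          simp only [hΨ]
          rw [this, exp_add]
          ring
        rw [e1, norm_eq_abs, abs_mul, abs_mul, abs_exp, abs_of_nonneg hM]
        have h6 : |exp D - 1| ≤ T * c * ν * (1 + ∑ j : Fin m, θ j.succ ^ 2) * exp B :=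
          (abs_exp_sub_one_le_mul_exp D).trans (mul_le_mul hDν (exp_le_exp.2 hDB) (exp_pos _).le
            ((abs_nonneg D).trans hDν))
        calc exp (t * g (θ 0)) * (M * |exp D - 1|)
            ≤ exp (t * g (θ 0)) * (M * (T * c * ν * (1 + ∑ j : Fin m, θ j.succ ^ 2) * exp B)) := by
              gcongr
          _ = _ := by ring)
    rw [integral_const_mul, hBi] at h1
    refine h1.trans ?_
    have h7 := hC₂ m (by omega)
    calc T * c * exp B * ν * (G * ∫ y, anchoredKernel β y * (1 + ∑ j, y j ^ 2) ∂circleMeasure m)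
        ≤ T * c * exp B * ν * (G * (C₂ * gaussianMass β m)) := by gcongr
      _ = _ := by rw [hK]; ring
  have he : exp (1 / (2 * β)) * exp (-(1 / (2 * β))) = 1 := by rw [← exp_add]; simp
  have h1 := hC₁ m (by omega)
  set E := exp (-(1 / (2 * β)))
  have hE0 : 0 < E := exp_pos _
  have hden : 0 < gaussianMass β m * E * G := by positivity
  have hn1 : (1 : ℝ) ≤ ((m + 1 : ℕ) : ℝ) := by push_cast; linarith [m.cast_nonneg (α := ℝ)]
  refine ⟨(J - gaussianMass β m * E * G) / (gaussianMass β m * E * G), ?_, ?_⟩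
  · rw [abs_div, abs_of_pos hden, div_le_iff₀ hden]
    have h2 := inv_natCast_le_rpow_neg (n := m + 1) (by omega) (ζ := ζ) (by linarith)
    have h3 : ν ≤ ((m + 1 : ℕ) : ℝ) ^ (-ζ) := rpow_le_rpow_of_exponent_le hn1 (by linarith)
    set ω := ((m + 1 : ℕ) : ℝ) ^ (-ζ)
    have h4 : C₁ / (m + 1) ≤ |C₁| * ω := by
      rw [div_eq_mul_one_div]
      push_cast at h2
      exact mul_le_mul (le_abs_self C₁) h2 (by positivity) (abs_nonneg C₁)
    have h5 : J - gaussianMass β m * E * G = (J - G * anchoredMass β m) +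
        G * (anchoredMass β m - gaussianMass β m * E) := by ring
    rw [h5]
    refine (abs_add_le _ _).trans ?_
    rw [abs_mul, abs_of_pos hG0]
    calc _ ≤ G * gaussianMass β m * (K * ω) + G * (|C₁| * ω * gaussianMass β m) := by
          refine add_le_add (hdiff.trans (by gcongr)) ?_
          refine mul_le_mul_of_nonneg_left (h1.trans ?_) hG0.le
          gcongr
      _ = (K + |C₁|) * ω * gaussianMass β m * G * (exp (1 / (2 * β)) * E) := by
          rw [he]; ring
      _ = _ := by ring
  · rw [multiIntegral_eq hβ, hIJ, hGi, leadingFactor_succ hβ, show exp (-(1 / (2 * β))) = E from rfl]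
    field_simp
    ring

end AntipodalCircle

theorem theorem1p2 (β : ℝ) (hβ : 0 < β) :
    (∀ (q : NNReal), 0 < q → q ≤ 1 →
      ∀ g : ℝ → ℝ, Function.Periodic g (2 * Real.pi) → MemHolder q g →
      ∀ ζ : ℝ, 0 < ζ → ζ < (q : ℝ) / 2 →
      ∀ K : Set ℝ, IsCompact K →
      ∃ C : ℝ, ∃ N : ℕ, ∀ n : ℕ, N ≤ n → ∀ t ∈ K,
        ∃ r : ℝ, |r| ≤ C * (n : ℝ) ^ (-ζ) ∧
          AntipodalCircle.multiIntegral β n (fun x => t / (n : ℝ) * g x) =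
            AntipodalCircle.leadingFactor β n * (1 + r) *
              ∫ θ in (-Real.pi)..Real.pi, Real.exp (t * g θ)) ∧
    (∀ n : ℕ, AntipodalCircle.partitionFunction β n =
      AntipodalCircle.multiIntegral β n (fun _ => 0)) ∧
    (∀ ζ : ℝ, 0 < ζ → ζ < 1 →
      ∃ C : ℝ, ∃ N : ℕ, ∀ n : ℕ, N ≤ n →
        ∃ r : ℝ, |r| ≤ C * (n : ℝ) ^ (-ζ) ∧
          AntipodalCircle.partitionFunction β n =
            AntipodalCircle.leadingFactor β n * (2 * Real.pi) * (1 + r)) := by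
  refine ⟨fun q hq0 hq1 g hper hg ζ _ hζ K hK => ?_,
    AntipodalCircle.partitionFunction_eq_multiIntegral β,
    fun ζ _ hζ => AntipodalCircle.partitionFunction_asymptotics hβ hζ.le⟩
  obtain ⟨T, hT⟩ := hK.isBounded.exists_norm_le
  obtain ⟨C, N, h⟩ := AntipodalCircle.multiIntegral_asymptotics hβ hq0 hq1 hper hg hζ.le
    (abs_nonneg T)
  exact ⟨C, N, fun n hn t ht => h n hn t ((hT t ht).trans (le_abs_self T))⟩
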